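/- **Setting ($\mathsf Q$-calculus).** Terms, taken modulo $\alpha$-conversion, are $$M ::= x \mid r \mid\; !M \mid 0 \mid 1 \mid U_i \mid \mathtt{new}(M) \mid M_1M_2 \mid \langle M_1,\dots,M_n\rangle \mid \lambda!x.M \mid \lambda\pi.M \qquad (n\ge 2),$$ where $x$ ranges over classical variables, $r$ over quantum variables, $U_0,U_1,\dots$ are symbols interpreted by fixed unitary operators $\mathbf U_i$ on $\mathbb C^{2^{n_i}}$, and a pattern $\pi$ is a classical variable or a tuple $\langle x_1,\dots,x_n\rangle$ ($n\ge2$) of classical variables. Environments $\Gamma$ are finite multisets of patterns $\pi$, duplicable variables $!x$ and quantum variables $r$, in which every variable name occurs at most once. Judgements $\Gamma\vdash M$ are derived by the rules: $\vdash C$ for constants $C\in\{0,1,U_i\}$; $r\vdash r$; $x\vdash x$; from $\Gamma\vdash M$ infer $\Gamma,!x\vdash M$; from $\Gamma,!x,!y\vdash M$ infer $\Gamma,!z\vdash M\{z/x,z/y\}$; from $!\Gamma\vdash M$ infer $!\Gamma\vdash\,!M$; from $\Gamma,x\vdash M$ infer $\Gamma,!x\vdash M$; from $\Gamma,x_1,\dots,x_k\vdash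 M$ infer $\Gamma,\langle x_1,\dots,x_k\rangle\vdash M$; from $\Gamma_i\vdash M_i$ ($1\le i\le k$) infer $\Gamma_1,\dots,\Gamma_k\vdash\langle M_1,\dots,M_k\rangle$; from $\Gamma\vdash M$ infer $\Gamma\vdash\mathtt{new}(M)$; from $\Gamma,\pi\vdash M$ infer $\Gamma\vdash\lambda\pi.M$; from $\Gamma,!x\vdash M$ infer $\Gamma\vdash\lambda!x.M$; from $\Gamma_1\vdash M_1$ and $\Gamma_2\vdash M_2$ infer $\Gamma_1,\Gamma_2\vdash M_1M_2$. A term $M$ is *well formed* if $\mathbf Q(M)\vdash M$ is derivable, where $\mathbf Q(M)$ is the set of quantum variables of $M$. Reduction acts on triples $[\mathcal Q,\mathcal{QV},M]$, where $\mathcal{QV}\supseteq\mathbf Q(M)$ is a finite set of quantum variables and $\mathcal Q\colon\{0,1\}^{\mathcal{QV}}\to\mathbb C$. Its rules, applied in every context except those of the form $!M$, are: $\mathsf{Uq}$ (the application of $U_i$ to a tuple of quantum variables applies $\mathbf U_i$ to these qubits of $\mathcal Q$ and returns the tuple), $\mathsf{new}$ ($\mathtt{new}(c)$ reduces to a fresh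 quantum variable $r$, and $\mathcal Q$ becomes $\mathcal Q\otimes|r\mapsto c\rangle$), $\mathsf{q.\beta}$ ($(\lambda\langle x_1,\dots,x_n\rangle.M)\langle r_1,\dots,r_n\rangle\to M\{r_1/x_1,\dots,r_n/x_n\}$), and the *classical* rules, which leave $\mathcal Q$ and $\mathcal{QV}$ unchanged: $$\mathsf{l.\beta}:\ (\lambda x.M)N\to M\{N/x\},\qquad \mathsf{c.\beta}:\ (\lambda!x.M)\,!N\to M\{N/x\},$$ $$\mathsf{l.cm}:\ L((\lambda\pi.M)N)\to(\lambda\pi.LM)N,\qquad \mathsf{r.cm}:\ ((\lambda\pi.M)N)L\to(\lambda\pi.ML)N$$ (in the last two no variable of $\pi$ is free in $L$). Let $\mathscr C=\{\mathsf{l.\beta},\mathsf{c.\beta},\mathsf{l.cm},\mathsf{r.cm}\}$. We write $M\to^*_{\mathscr C}N$ if $[\mathcal Q,\mathbf Q(M),M]$ reduces in finitely many steps with rules in $\mathscr C$ to a triple with term $N$, for every $\mathcal Q$ (the choice of $\mathcal Q$ is immaterial); normal forms are understood with respect to the rules in $\mathscr C$. Natural numbers are encoded by the numerals $\ulcorner0\urcorner=\lambda!x.\lambda!y.y$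 and $\ulcorner n+1\urcorner=\lambda!x.\lambda!y.x\,!\ulcorner n\urcorner$. A partial function $f$ from $\mathbb N^n$ to $\mathbb N$ is *representable* if there is a well-formed term $M_f$ such that for all $m_1,\dots,m_n\in\mathbb N$: 1. whenever $M_f\ulcorner m_1\urcorner\cdots\ulcorner m_n\urcorner\to^*_{\mathscr C}N$ with $N$ in normal form, then $N=\ulcorner m\urcorner$ for some $m\in\mathbb N$; 2. for every $m\in\mathbb N$, $M_f\ulcorner m_1\urcorner\cdots\ulcorner m_n\urcorner\to^*_{\mathscr C}\ulcorner m\urcorner$ if and only if $f(m_1,\dots,m_n)$ is defined and equal to $m$. **Proposition.** For every $n\ge0$, and for every interpretation of the symbols $U_i$ by unitary operators, the class of representable partial functions from $\mathbb N^n$ to $\mathbb N$ coincides with the class of $n$-ary partial recursive functions. -/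

import Mathlib

/-! The untyped quantum lambda calculus with classical control (the `Q`-calculus). -/

noncomputable section

namespace QCalc

/-- Terms modulo `α`-conversion, in de Bruijn form. A variable that is not captured by a binder
stands for a free classical variable: at the top level `var i` is the classical variable `v_i`.

* `qvar r` is the quantum variable `r`, `bool b` a boolean constant, `unitary i` the symbol `U_i`;
* `tuple n M` is the tuple of the `n + 2` terms `M 0, …, M (n + 1)`;
* `lamBang M` is `λ!x.M`;
* `lam k M` is `λπ.M` for a pattern `π` with `k + 1` variables. For `k = 0` the pattern is a single
  variable `x`, for `k ≥ 1` it is the tuple `⟨x_0, …, x_k⟩`; in the body, the de Bruijn index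
  `i ≤ k` refers to `x_i`. -/
inductive Term : Type
  | var (i : ℕ)
  | qvar (r : ℕ)
  | bang (M : Term)
  | bool (b : Bool)
  | unitary (i : ℕ)
  | new (M : Term)
  | app (M N : Term)
  | tuple (n : ℕ) (M : Fin (n + 2) → Term)
  | lamBang (M : Term)
  | lam (k : ℕ) (M : Term)

namespace Term

/-- The set of quantum variables occurring in a term. -/
def qvars : Term → Finset ℕ
  | var _ => ∅
  | qvar r => {r}
  | bang M => M.qvars
  | bool _ => ∅
  | unitary _ => ∅
  | new M => M.qvars
  | app M N => M.qvars ∪ N.qvars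
  | tuple _ M => Finset.univ.biUnion fun i => (M i).qvars
  | lamBang M => M.qvars
  | lam _ M => M.qvars

/-- A renaming of variables, pushed under `k` bound variables. -/
def liftRen (k : ℕ) (ρ : ℕ → ℕ) : ℕ → ℕ :=
  fun i => if i < k then i else ρ (i - k) + k

/-- Capture-avoiding renaming of the free classical variables. -/
def rename : (ℕ → ℕ) → Term → Term
  | ρ, var i => var (ρ i)
  | _, qvar r => qvar r
  | ρ, bang M => bang (M.rename ρ)
  | _, bool b => bool b
  | _, unitary i => unitary i
  | ρ, new M => new (M.rename ρ)
  | ρ, app M N => app (M.rename ρ) (N.rename ρ)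
  | ρ, tuple n M => tuple n fun i => (M i).rename ρ
  | ρ, lamBang M => lamBang (M.rename (liftRen 1 ρ))
  | ρ, lam k M => lam k (M.rename (liftRen (k + 1) ρ))

/-- Weakening of a term by `k` new innermost bound variables. -/
def shift (k : ℕ) (M : Term) : Term := M.rename fun i => i + k

/-- A substitution, pushed under `k` bound variables. -/
def liftSub (k : ℕ) (σ : ℕ → Term) : ℕ → Term :=
  fun i => if i < k then var i else (σ (i - k)).shift k

/-- Capture-avoiding simultaneous substitution for the free classical variables. -/
def subst : (ℕ → Term) → Term → Term
  | σ, var i => σ i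
  | _, qvar r => qvar r
  | σ, bang M => bang (M.subst σ)
  | _, bool b => bool b
  | _, unitary i => unitary i
  | σ, new M => new (M.subst σ)
  | σ, app M N => app (M.subst σ) (N.subst σ)
  | σ, tuple n M => tuple n fun i => (M i).subst σ
  | σ, lamBang M => lamBang (M.subst (liftSub 1 σ))
  | σ, lam k M => lam k (M.subst (liftSub (k + 1) σ))

/-- `M{N_0/x_0, …, N_{k-1}/x_{k-1}}`, where `x_0, …, x_{k-1}` are the innermost `k` bound variables,
whose binder disappears. -/
def inst {k : ℕ} (M : Term) (N : Fin k → Term) : Term :=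
  M.subst fun i => if h : i < k then N ⟨i, h⟩ else var (i - k)

/-- The body of the abstraction of `M` over the (distinct) free variables `xs 0, …, xs k`: the
variable `xs i` becomes the bound variable with de Bruijn index `i`, and the de Bruijn indices of
all other free variables are raised by `k + 1`. -/
def abstr {k : ℕ} (xs : Fin (k + 1) → ℕ) (M : Term) : Term :=
  M.rename (Function.extend xs (fun i => (i : ℕ)) (fun y => y + (k + 1)))

/-- The numerals: `⌜0⌝ = λ!x.λ!y.y` and `⌜n+1⌝ = λ!x.λ!y.x !⌜n⌝`. -/
def num : ℕ → Term
  | 0 => lamBang (lamBang (var 0))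
  | n + 1 => lamBang (lamBang (app (var 1) (bang (num n))))

/-- The iterated application `M ⌜m_1⌝ … ⌜m_n⌝`. -/
def appNums (M : Term) {n : ℕ} (v : List.Vector ℕ n) : Term :=
  v.toList.foldl (fun t m => app t (num m)) M

end Term

/-! ### Well-formed terms -/

/-- The entries of an environment: patterns (a single variable for `k = 0`, a tuple of variables
for `k ≥ 1`), duplicable variables `!x`, and quantum variables. -/
inductive Entry : Type
  | pat (k : ℕ) (xs : Fin (k + 1) → ℕ)
  | bang (x : ℕ)
  | qvar (r : ℕ)

/-- The pattern consisting of a single classical variable. -/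
def Entry.lin (x : ℕ) : Entry := Entry.pat 0 fun _ => x

/-- The names in an entry; `Sum.inl` marks classical and `Sum.inr` quantum variables. -/
def Entry.names : Entry → Multiset (ℕ ⊕ ℕ)
  | .pat _ xs => Finset.univ.val.map fun i => Sum.inl (xs i)
  | .bang x => {Sum.inl x}
  | .qvar r => {Sum.inr r}

/-- Environments are finite multisets of entries. -/
abbrev Env : Type := Multiset Entry

/-- Each variable name occurs at most once in the environment. -/
def Env.Distinct (Γ : Env) : Prop := (Multiset.bind Γ Entry.names).Nodup

/-- The derivable judgements `Γ ⊢ M`. -/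
inductive Judgement : Env → Term → Prop
  | const_bool (b : Bool) : Judgement 0 (.bool b)
  | const_unitary (i : ℕ) : Judgement 0 (.unitary i)
  | qvar (r : ℕ) : Judgement {.qvar r} (.qvar r)
  | var (x : ℕ) : Judgement {.lin x} (.var x)
  | weak {Γ : Env} {M : Term} (x : ℕ) :
      Judgement Γ M → Env.Distinct (.bang x ::ₘ Γ) → Judgement (.bang x ::ₘ Γ) M
  | contr {Γ : Env} {M : Term} (x y z : ℕ) :
      Judgement (.bang x ::ₘ .bang y ::ₘ Γ) M → Env.Distinct (.bang z ::ₘ Γ) →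
      Judgement (.bang z ::ₘ Γ) (M.rename fun w => if w = x ∨ w = y then z else w)
  | prom {Δ : Multiset ℕ} {M : Term} :
      Judgement (Δ.map .bang) M → Judgement (Δ.map .bang) (.bang M)
  | der {Γ : Env} {M : Term} (x : ℕ) :
      Judgement (.lin x ::ₘ Γ) M → Judgement (.bang x ::ₘ Γ) M
  | ltens {Γ : Env} {M : Term} (n : ℕ) (xs : Fin (n + 2) → ℕ) :
      Judgement (Finset.univ.val.map (fun i => Entry.lin (xs i)) + Γ) M →
      Judgement (.pat (n + 1) xs ::ₘ Γ) M
  | rtens (n : ℕ) (Γ : Fin (n + 2) → Env) (M : Fin (n + 2) → Term) :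
      (∀ i, Judgement (Γ i) (M i)) → Env.Distinct (∑ i, Γ i) →
      Judgement (∑ i, Γ i) (.tuple n M)
  | new {Γ : Env} {M : Term} : Judgement Γ M → Judgement Γ (.new M)
  | limp_intro {Γ : Env} {M : Term} (k : ℕ) (xs : Fin (k + 1) → ℕ) :
      Judgement (.pat k xs ::ₘ Γ) M → Judgement Γ (.lam k (M.abstr xs))
  | to_intro {Γ : Env} {M : Term} (x : ℕ) :
      Judgement (.bang x ::ₘ Γ) M → Judgement Γ (.lamBang (M.abstr (k := 0) fun _ => x))
  | app {Γ₁ Γ₂ : Env} {M N : Term} :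
      Judgement Γ₁ M → Judgement Γ₂ N → Env.Distinct (Γ₁ + Γ₂) → Judgement (Γ₁ + Γ₂) (.app M N)

/-- A term is well formed if it is so in the environment made of its quantum variables. -/
def Term.WellFormed (M : Term) : Prop := Judgement (M.qvars.val.map .qvar) M

/-! ### Configurations and reduction -/

/-- The space `ℋ(V)` of the functions `{0,1}^V → ℂ`, for a finite set `V` of quantum variables. -/
abbrev Hilb (V : Finset ℕ) : Type := (V → Bool) → ℂ

/-- `Q ⊗ |r ↦ c⟩`. -/
def Hilb.tensorKet {V : Finset ℕ} (Q : Hilb V) (r : ℕ) (c : Bool) : Hilb (insert r V) :=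
  fun f => if f ⟨r, Finset.mem_insert_self r V⟩ = c then
    Q fun q => f ⟨q, Finset.mem_insert_of_mem q.2⟩ else 0

/-- An `n`-qubit gate: a unitary operator on `ℂ^(2^n)`, as a matrix in the standard basis. -/
abbrev Gate (n : ℕ) : Type := Matrix.unitaryGroup (Fin n → Bool) ℂ

/-- The application of a gate to the (distinct) quantum variables `r 0, …, r (n-1)` of a register;
it acts as the identity on the other variables. -/
def Gate.act {n : ℕ} (G : Gate n) {V : Finset ℕ} (r : Fin n → V) (Q : Hilb V) : Hilb V :=
  fun f => ∑ g : Fin n → Bool,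
    (G : Matrix (Fin n → Bool) (Fin n → Bool) ℂ) (fun i => f (r i)) g * Q (Function.extend r g f)

/-- The triples `[Q, V, M]`. -/
structure PreConfig : Type where
  qvs : Finset ℕ
  reg : Hilb qvs
  term : Term

/-- The condition on a triple `[Q, V, M]` that the quantum variables of `M` lie in `V`. -/
def PreConfig.Ok (C : PreConfig) : Prop := C.term.qvars ⊆ C.qvs

/-- The preconfiguration `[Q, M] = [Q, Qvar(M), M]`. -/
def PreConfig.ofTerm (M : Term) (Q : Hilb M.qvars) : PreConfig := ⟨M.qvars, Q, M⟩

/-- The names of the reduction rules. -/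
inductive Label : Type
  | Uq
  | new
  | lβ
  | qβ
  | cβ
  | lcm
  | rcm

/-- One-step reduction by the rule `α`, in any context except those of the form `!M`. The symbol
`U_i` is interpreted by the gate `U i`; as tuples have at least two components, a gate on one qubit
is applied to a quantum variable. -/
inductive Step (U : ℕ → Σ n, Gate n) : Label → PreConfig → PreConfig → Prop
  | Uq_one {V : Finset ℕ} {Q : Hilb V} (i : ℕ) (G : Gate 1) (r : V) :
      U i = ⟨1, G⟩ →
      Step U .Uq ⟨V, Q, .app (.unitary i) (.qvar r)⟩ ⟨V, G.act (fun _ => r) Q, .qvar r⟩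
  | Uq {V : Finset ℕ} {Q : Hilb V} (i n : ℕ) (G : Gate (n + 2)) (r : Fin (n + 2) → V) :
      U i = ⟨n + 2, G⟩ → Function.Injective r →
      Step U .Uq ⟨V, Q, .app (.unitary i) (.tuple n fun j => .qvar (r j))⟩
        ⟨V, G.act r Q, .tuple n fun j => .qvar (r j)⟩
  | new {V : Finset ℕ} {Q : Hilb V} (c : Bool) (r : ℕ) : r ∉ V →
      Step U .new ⟨V, Q, .new (.bool c)⟩ ⟨insert r V, Q.tensorKet r c, .qvar r⟩
  | lβ {V : Finset ℕ} {Q : Hilb V} (M N : Term) :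
      PreConfig.Ok ⟨V, Q, .app (.lam 0 M) N⟩ →
      Step U .lβ ⟨V, Q, .app (.lam 0 M) N⟩ ⟨V, Q, M.inst (k := 1) fun _ => N⟩
  | qβ {V : Finset ℕ} {Q : Hilb V} (n : ℕ) (M : Term) (r : Fin (n + 2) → ℕ) :
      PreConfig.Ok ⟨V, Q, .app (.lam (n + 1) M) (.tuple n fun j => .qvar (r j))⟩ →
      Step U .qβ ⟨V, Q, .app (.lam (n + 1) M) (.tuple n fun j => .qvar (r j))⟩
        ⟨V, Q, M.inst fun j => .qvar (r j)⟩
  | cβ {V : Finset ℕ} {Q : Hilb V} (M N : Term) :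
      PreConfig.Ok ⟨V, Q, .app (.lamBang M) (.bang N)⟩ →
      Step U .cβ ⟨V, Q, .app (.lamBang M) (.bang N)⟩ ⟨V, Q, M.inst (k := 1) fun _ => N⟩
  | lcm {V : Finset ℕ} {Q : Hilb V} (k : ℕ) (L M N : Term) :
      PreConfig.Ok ⟨V, Q, .app L (.app (.lam k M) N)⟩ →
      Step U .lcm ⟨V, Q, .app L (.app (.lam k M) N)⟩
        ⟨V, Q, .app (.lam k (.app (L.shift (k + 1)) M)) N⟩
  | rcm {V : Finset ℕ} {Q : Hilb V} (k : ℕ) (L M N : Term) :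
      PreConfig.Ok ⟨V, Q, .app (.app (.lam k M) N) L⟩ →
      Step U .rcm ⟨V, Q, .app (.app (.lam k M) N) L⟩
        ⟨V, Q, .app (.lam k (.app M (L.shift (k + 1)))) N⟩
  | tuple {α : Label} {V V' : Finset ℕ} {Q : Hilb V} {Q' : Hilb V'} (n : ℕ)
      (M : Fin (n + 2) → Term) (i : Fin (n + 2)) (M' : Term) :
      Step U α ⟨V, Q, M i⟩ ⟨V', Q', M'⟩ → PreConfig.Ok ⟨V, Q, .tuple n M⟩ →
      Step U α ⟨V, Q, .tuple n M⟩ ⟨V', Q', .tuple n (Function.update M i M')⟩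
  | app_right {α : Label} {V V' : Finset ℕ} {Q : Hilb V} {Q' : Hilb V'} {M N N' : Term} :
      Step U α ⟨V, Q, N⟩ ⟨V', Q', N'⟩ → PreConfig.Ok ⟨V, Q, .app M N⟩ →
      Step U α ⟨V, Q, .app M N⟩ ⟨V', Q', .app M N'⟩
  | app_left {α : Label} {V V' : Finset ℕ} {Q : Hilb V} {Q' : Hilb V'} {M M' N : Term} :
      Step U α ⟨V, Q, M⟩ ⟨V', Q', M'⟩ → PreConfig.Ok ⟨V, Q, .app M N⟩ →
      Step U α ⟨V, Q, .app M N⟩ ⟨V', Q', .app M' N⟩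
  | in_new {α : Label} {V V' : Finset ℕ} {Q : Hilb V} {Q' : Hilb V'} {M M' : Term} :
      Step U α ⟨V, Q, M⟩ ⟨V', Q', M'⟩ → Step U α ⟨V, Q, .new M⟩ ⟨V', Q', .new M'⟩
  | in_lamBang {α : Label} {V V' : Finset ℕ} {Q : Hilb V} {Q' : Hilb V'} {M M' : Term} :
      Step U α ⟨V, Q, M⟩ ⟨V', Q', M'⟩ → Step U α ⟨V, Q, .lamBang M⟩ ⟨V', Q', .lamBang M'⟩
  | in_lam {α : Label} {V V' : Finset ℕ} {Q : Hilb V} {Q' : Hilb V'} {M M' : Term} (k : ℕ) :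
      Step U α ⟨V, Q, M⟩ ⟨V', Q', M'⟩ → Step U α ⟨V, Q, .lam k M⟩ ⟨V', Q', .lam k M'⟩

/-- The classical rules: all rules but `Uq`, `qβ` and `new`. -/
def classical : Set Label := {.Uq, .qβ, .new}ᶜ

/-- The union of the one-step reduction relations for the rules in `S`. -/
def StepIn (U : ℕ → Σ n, Gate n) (S : Set Label) (C C' : PreConfig) : Prop :=
  ∃ α ∈ S, Step U α C C'

/-- The reflexive and transitive closure of `StepIn`. -/
def Reduces (U : ℕ → Σ n, Gate n) (S : Set Label) : PreConfig → PreConfig → Prop :=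
  Relation.ReflTransGen (StepIn U S)

/-- Normal forms with respect to the rules in `S`. -/
def IsNormal (U : ℕ → Σ n, Gate n) (S : Set Label) (C : PreConfig) : Prop :=
  ∀ C', ¬ StepIn U S C C'

/-- The term `M` represents the partial function `f` with respect to classical reduction: whenever
`M ⌜m_1⌝ … ⌜m_n⌝` has a normal form, this is a numeral; and `M ⌜m_1⌝ … ⌜m_n⌝` reduces to `⌜m⌝` iff
`f (m_1, …, m_n)` is defined and equal to `m`. Reduction acts on configurations, so this is asked
for every register `Q` on the quantum variables of the term. -/
def Represents (U : ℕ → Σ n, Gate n) (M : Term) {n : ℕ} (f : List.Vector ℕ n →. ℕ) : Prop :=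
  ∀ (v : List.Vector ℕ n) (Q : Hilb (M.appNums v).qvars),
    (∀ C, Reduces U classical (.ofTerm (M.appNums v) Q) C → IsNormal U classical C →
      ∃ m, C.term = Term.num m) ∧
    ∀ m, (∃ C, Reduces U classical (.ofTerm (M.appNums v) Q) C ∧ C.term = Term.num m) ↔ m ∈ f v

/-- A partial function on the natural numbers is representable if a well-formed term
represents it. -/
def Representable (U : ℕ → Σ n, Gate n) {n : ℕ} (f : List.Vector ℕ n →. ℕ) : Prop :=
  ∃ M : Term, M.WellFormed ∧ Represents U M f

end QCalc

end

noncomputable section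

namespace QCalc

namespace Term

/-! ### Renaming and substitution -/

/-! Classical steps neither read nor change the register, so everything can be phrased with a
rewriting relation `TStep` on terms (`represents_iff`).

Representable implies partial recursive. After an injective coding of terms by numbers, reduction in
finitely many steps is the least relation closed under a finite list of Horn clauses
(`tSteps_iff_der`). Derivability from such clauses is recursively enumerable, so the graph of a
representable function is too, and unbounded search computes the function
(`partrec_of_mem_iff_der`).

Partial recursive implies representable. `Turing.ToPartrec.Code` programs are compiled to closed
terms built from variables, `!`, application and `λ!`, with Scott-style lists and loops by
self-application. A box `!M` is frozen, so contracting a `cβ`-redex never duplicates or erases a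
redex: in this fragment two different steps from a term are joined by exactly one step on each side
(`CStep.diamond`). Hence a term with a normal form is strongly normalizing, and so are its subterms
outside boxes. A defined program therefore reduces to its value (`cSteps_codeTerm`), and a compiled
program with any normal form has a defined value (`dom_eval_of_sn`), which excludes spurious normal
forms.

Two points remain. Numerals are supplied unboxed, so the arguments must be bound by linear
abstractions, each used once; `buildTerm` turns each of them into a boxed numeral by one case
distinction. The linear abstractions bring `lβ` and commuting steps into play; the relation `Unfold`
shows that these do not affect the underlying computation. Well-formedness of the compiled terms
comes from renaming apart and contraction (`Term.PureBelow.judgement`). -/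

theorem liftRen_comp (k : ℕ) (ρ ρ' : ℕ → ℕ) :
    liftRen k ρ' ∘ liftRen k ρ = liftRen k (ρ' ∘ ρ) := by
  funext i
  by_cases h : i < k
  · simp [liftRen, h]
  · simp [liftRen, h]

theorem rename_rename (M : Term) (ρ ρ' : ℕ → ℕ) :
    (M.rename ρ).rename ρ' = M.rename (ρ' ∘ ρ) := by
  induction M generalizing ρ ρ' with
  | var | qvar | bool | unitary => rfl
  | bang M ih => simp [rename, ih]
  | new M ih => simp [rename, ih]
  | app M N ihM ihN => simp [rename, ihM, ihN]
  | tuple n M ih => simp [rename, ih]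
  | lamBang M ih => simp [rename, ih, liftRen_comp]
  | lam k M ih => simp [rename, ih, liftRen_comp]

/-- Lifts accumulate, so the coded version of shifting only has to track the total number of binders
crossed. `liftSub_liftSub` plays the same role for substitution. -/
theorem liftRen_liftRen (b c : ℕ) (ρ : ℕ → ℕ) :
    liftRen b (liftRen c ρ) = liftRen (c + b) ρ := by
  funext i
  by_cases h : i < b
  · simp [liftRen, h, show i < c + b by omega]
  · by_cases h' : i < c + b
    · simp [liftRen, h, h', show i - b < c by omega]; omega
    · simp [liftRen, h, h', show ¬ i - b < c by omega, add_assoc, Nat.sub_sub, Nat.add_comm b c]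

theorem liftSub_comp_liftRen (k : ℕ) (ρ : ℕ → ℕ) (σ : ℕ → Term) :
    liftSub k σ ∘ liftRen k ρ = liftSub k (σ ∘ ρ) := by
  funext i
  by_cases h : i < k
  · simp [liftRen, liftSub, h]
  · simp [liftRen, liftSub, h]

theorem subst_rename (M : Term) (ρ : ℕ → ℕ) (σ : ℕ → Term) :
    (M.rename ρ).subst σ = M.subst (σ ∘ ρ) := by
  induction M generalizing ρ σ with
  | var | qvar | bool | unitary => rfl
  | bang M ih => simp [rename, subst, ih]
  | new M ih => simp [rename, subst, ih]
  | app M N ihM ihN => simp [rename, subst, ihM, ihN]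
  | tuple n M ih => simp [rename, subst, ih]
  | lamBang M ih => simp [rename, subst, ih, liftSub_comp_liftRen]
  | lam k M ih => simp [rename, subst, ih, liftSub_comp_liftRen]

theorem rename_liftSub (k : ℕ) (ρ : ℕ → ℕ) (σ : ℕ → Term) :
    (fun i => (liftSub k σ i).rename (liftRen k ρ)) = liftSub k (fun i => (σ i).rename ρ) := by
  funext i
  by_cases h : i < k
  · simp [liftSub, h, rename, liftRen]
  · simp only [liftSub, h, if_false, shift, rename_rename]
    congr 1
    funext j
    simp [liftRen]

theorem rename_subst (M : Term) (ρ : ℕ → ℕ) (σ : ℕ → Term) :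
    (M.subst σ).rename ρ = M.subst fun i => (σ i).rename ρ := by
  induction M generalizing ρ σ with
  | var | qvar | bool | unitary => rfl
  | bang M ih => simp [rename, subst, ih]
  | new M ih => simp [rename, subst, ih]
  | app M N ihM ihN => simp [rename, subst, ihM, ihN]
  | tuple n M ih => simp [rename, subst, ih]
  | lamBang M ih => simp [rename, subst, ih, rename_liftSub]
  | lam k M ih => simp [rename, subst, ih, rename_liftSub]

theorem subst_liftSub (k : ℕ) (σ τ : ℕ → Term) :
    (fun i => (liftSub k σ i).subst (liftSub k τ)) = liftSub k (fun i => (σ i).subst τ) := by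
  funext i
  by_cases h : i < k
  · simp [liftSub, h, subst]
  · simp only [liftSub, h, if_false, shift, subst_rename, rename_subst]
    congr 1
    funext j
    simp [liftSub, shift]

theorem subst_subst (M : Term) (σ τ : ℕ → Term) :
    (M.subst σ).subst τ = M.subst fun i => (σ i).subst τ := by
  induction M generalizing σ τ with
  | var | qvar | bool | unitary => rfl
  | bang M ih => simp [subst, ih]
  | new M ih => simp [subst, ih]
  | app M N ihM ihN => simp [subst, ihM, ihN]
  | tuple n M ih => simp [subst, ih]
  | lamBang M ih => simp [subst, ih, subst_liftSub]
  | lam k M ih => simp [subst, ih, subst_liftSub]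

@[simp] theorem liftSub_var (k : ℕ) : liftSub k var = var := by
  funext i
  by_cases h : i < k
  · simp [liftSub, h]
  · simp [liftSub, h, shift, rename, Nat.sub_add_cancel (not_lt.1 h)]

@[simp] theorem subst_var (M : Term) : M.subst var = M := by
  induction M with
  | var | qvar | bool | unitary => rfl
  | bang M ih => simp [subst, ih]
  | new M ih => simp [subst, ih]
  | app M N ihM ihN => simp [subst, ihM, ihN]
  | tuple n M ih => simp [subst, ih]
  | lamBang M ih => simp [subst, ih]
  | lam k M ih => simp [subst, ih]

theorem rename_eq_subst (M : Term) (ρ : ℕ → ℕ) : M.rename ρ = M.subst fun i => var (ρ i) := by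
  rw [← subst_var (M.rename ρ), subst_rename]
  rfl

/-- The substitution of `N` for the variable with index `0`. -/
def single (N : Term) : ℕ → Term
  | 0 => N
  | i + 1 => var i

@[simp] theorem single_zero (N : Term) : single N 0 = N := rfl

@[simp] theorem single_succ (N : Term) (i : ℕ) : single N (i + 1) = var i := rfl

theorem inst_eq_subst_single (M N : Term) : (M.inst (k := 1) fun _ => N) = M.subst (single N) := by
  unfold inst
  congr 1
  funext i
  cases i <;> simp

@[simp] theorem liftSub_one_zero (σ : ℕ → Term) : liftSub 1 σ 0 = var 0 := rfl

@[simp] theorem liftSub_one_succ (σ : ℕ → Term) (i : ℕ) :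
    liftSub 1 σ (i + 1) = (σ i).shift 1 := rfl

@[simp] theorem shift_subst_single (M N : Term) : (M.shift 1).subst (single N) = M := by
  rw [shift, subst_rename]
  exact subst_var M

/-- The substitution lemma, by which a `cβ`-step remains a step after substitution (`CStep.subst`).
-/
theorem subst_single_subst (M N : Term) (σ : ℕ → Term) :
    (M.subst (single N)).subst σ = (M.subst (liftSub 1 σ)).subst (single (N.subst σ)) := by
  rw [subst_subst, subst_subst]
  congr 1
  funext i
  cases i <;> simp [subst]

theorem shift_shift (M : Term) (k l : ℕ) : (M.shift k).shift l = M.shift (k + l) := by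
  rw [shift, shift, rename_rename, shift]
  congr 1
  funext i
  simp [add_assoc]

theorem liftSub_liftSub (b c : ℕ) (σ : ℕ → Term) :
    liftSub b (liftSub c σ) = liftSub (c + b) σ := by
  funext i
  by_cases h : i < b
  · simp [liftSub, h, show i < c + b by omega]
  · by_cases h' : i < c + b
    · simp [liftSub, h, h', show i - b < c by omega, shift, rename]; omega
    · simp [liftSub, h, h', show ¬ i - b < c by omega, shift_shift, Nat.sub_sub, Nat.add_comm b c]

theorem qvars_rename (M : Term) (ρ : ℕ → ℕ) : (M.rename ρ).qvars = M.qvars := by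
  induction M generalizing ρ with
  | var | qvar | bool | unitary => rfl
  | bang M ih => simp [rename, qvars, ih]
  | new M ih => simp [rename, qvars, ih]
  | app M N ihM ihN => simp [rename, qvars, ihM, ihN]
  | tuple n M ih => simp [rename, qvars, ih]
  | lamBang M ih => simp [rename, qvars, ih]
  | lam k M ih => simp [rename, qvars, ih]

theorem qvars_liftSub {S : Finset ℕ} {σ : ℕ → Term} (h : ∀ i, (σ i).qvars ⊆ S) (k i : ℕ) :
    (liftSub k σ i).qvars ⊆ S := by
  unfold liftSub
  split_ifs
  · simp [qvars]
  · rw [shift, qvars_rename]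
    exact h _

theorem qvars_subst_subset {S : Finset ℕ} {M : Term} {σ : ℕ → Term} (hM : M.qvars ⊆ S)
    (h : ∀ i, (σ i).qvars ⊆ S) : (M.subst σ).qvars ⊆ S := by
  induction M generalizing σ with
  | var i => exact h i
  | qvar | bool | unitary => exact hM
  | bang M ih => exact ih hM h
  | new M ih => exact ih hM h
  | app M N ihM ihN =>
    simp only [qvars, Finset.union_subset_iff] at hM
    exact Finset.union_subset (ihM hM.1 h) (ihN hM.2 h)
  | tuple n M ih =>
    simp only [qvars, Finset.biUnion_subset] at hM
    simp only [subst, qvars, Finset.biUnion_subset]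
    exact fun i hi => ih i (hM i hi) h
  | lamBang M ih => exact ih (σ := liftSub 1 σ) hM (qvars_liftSub h 1)
  | lam k M ih => exact ih (σ := liftSub (k + 1) σ) hM (qvars_liftSub h _)

theorem qvars_single {S : Finset ℕ} {N : Term} (h : N.qvars ⊆ S) (i : ℕ) :
    (single N i).qvars ⊆ S := by
  cases i
  · exact h
  · simp [qvars]

end Term

/-! ### Classical reduction on terms -/

open Term

/-- One step of classical reduction, on terms. -/
inductive TStep : Term → Term → Prop
  | lβ (M N : Term) : TStep (.app (.lam 0 M) N) (M.subst (single N))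
  | cβ (M N : Term) : TStep (.app (.lamBang M) (.bang N)) (M.subst (single N))
  | lcm (k : ℕ) (L M N : Term) :
      TStep (.app L (.app (.lam k M) N)) (.app (.lam k (.app (L.shift (k + 1)) M)) N)
  | rcm (k : ℕ) (L M N : Term) :
      TStep (.app (.app (.lam k M) N) L) (.app (.lam k (.app M (L.shift (k + 1)))) N)
  | tuple (n : ℕ) (M : Fin (n + 2) → Term) (i : Fin (n + 2)) (M' : Term) :
      TStep (M i) M' → TStep (.tuple n M) (.tuple n (Function.update M i M'))
  | app_right {M N N' : Term} : TStep N N' → TStep (.app M N) (.app M N')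
  | app_left {M M' N : Term} : TStep M M' → TStep (.app M N) (.app M' N)
  | in_new {M M' : Term} : TStep M M' → TStep (.new M) (.new M')
  | in_lamBang {M M' : Term} : TStep M M' → TStep (.lamBang M) (.lamBang M')
  | in_lam {M M' : Term} (k : ℕ) : TStep M M' → TStep (.lam k M) (.lam k M')

/-- A contraction may erase quantum variables but creates none. The variable set of the initial term
thus suffices along a whole reduction, and the side condition `PreConfig.Ok` is preserved. -/
theorem TStep.qvars_subset {M M' : Term} (h : TStep M M') : M'.qvars ⊆ M.qvars := by
  induction h with
  | lβ M N | cβ M N =>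
    exact qvars_subst_subset (S := M.qvars ∪ N.qvars) Finset.subset_union_left
      (qvars_single Finset.subset_union_right)
  | lcm k L M N | rcm k L M N =>
    simp only [qvars, shift, qvars_rename]
    intro x
    simp only [Finset.mem_union]
    tauto
  | tuple n M i M' _ ih =>
    simp only [qvars, Finset.biUnion_subset]
    intro j _
    by_cases hj : j = i
    · subst hj
      simpa using ih.trans (Finset.subset_biUnion_of_mem (fun i => (M i).qvars) (Finset.mem_univ j))
    · simpa [hj] using Finset.subset_biUnion_of_mem (fun i => (M i).qvars) (Finset.mem_univ j)
  | app_right _ ih => exact Finset.union_subset_union le_rfl ih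
  | app_left _ ih => exact Finset.union_subset_union ih le_rfl
  | in_new _ ih => exact ih
  | in_lamBang _ ih => exact ih
  | in_lam _ _ ih => exact ih

theorem Step.tStep {U : ℕ → Σ n, Gate n} {α : Label} {C C' : PreConfig} (h : Step U α C C')
    (hα : α ∈ classical) : ∃ M', C' = ⟨C.qvs, C.reg, M'⟩ ∧ TStep C.term M' := by
  induction h with
  | Uq_one | Uq | new | qβ => simp [classical] at hα
  | lβ M N _ => exact ⟨_, rfl, inst_eq_subst_single M N ▸ .lβ M N⟩
  | cβ M N _ => exact ⟨_, rfl, inst_eq_subst_single M N ▸ .cβ M N⟩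
  | lcm k L M N _ => exact ⟨_, rfl, .lcm k L M N⟩
  | rcm k L M N _ => exact ⟨_, rfl, .rcm k L M N⟩
  | tuple n M i M' _ _ ih =>
    obtain ⟨_, h, h'⟩ := ih hα
    cases h
    exact ⟨_, rfl, .tuple n M i _ h'⟩
  | app_right _ _ ih =>
    obtain ⟨_, h, h'⟩ := ih hα
    cases h
    exact ⟨_, rfl, .app_right h'⟩
  | app_left _ _ ih =>
    obtain ⟨_, h, h'⟩ := ih hα
    cases h
    exact ⟨_, rfl, .app_left h'⟩
  | in_new _ ih =>
    obtain ⟨_, h, h'⟩ := ih hα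
    cases h
    exact ⟨_, rfl, .in_new h'⟩
  | in_lamBang _ ih =>
    obtain ⟨_, h, h'⟩ := ih hα
    cases h
    exact ⟨_, rfl, .in_lamBang h'⟩
  | in_lam k _ ih =>
    obtain ⟨_, h, h'⟩ := ih hα
    cases h
    exact ⟨_, rfl, .in_lam k h'⟩

theorem TStep.stepIn (U : ℕ → Σ n, Gate n) {M M' : Term} (h : TStep M M') {V : Finset ℕ}
    (Q : Hilb V) (hM : M.qvars ⊆ V) : StepIn U classical ⟨V, Q, M⟩ ⟨V, Q, M'⟩ := by
  induction h with
  | lβ M N => exact ⟨.lβ, by simp [classical], inst_eq_subst_single M N ▸ .lβ M N hM⟩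
  | cβ M N => exact ⟨.cβ, by simp [classical], inst_eq_subst_single M N ▸ .cβ M N hM⟩
  | lcm k L M N => exact ⟨.lcm, by simp [classical], .lcm k L M N hM⟩
  | rcm k L M N => exact ⟨.rcm, by simp [classical], .rcm k L M N hM⟩
  | tuple n M i M' _ ih =>
    obtain ⟨α, hα, h⟩ := ih
      ((Finset.subset_biUnion_of_mem (fun i => (M i).qvars) (Finset.mem_univ i)).trans hM)
    exact ⟨α, hα, .tuple n M i M' h hM⟩
  | app_right _ ih =>
    obtain ⟨α, hα, h⟩ := ih (Finset.subset_union_right.trans hM)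
    exact ⟨α, hα, .app_right h hM⟩
  | app_left _ ih =>
    obtain ⟨α, hα, h⟩ := ih (Finset.subset_union_left.trans hM)
    exact ⟨α, hα, .app_left h hM⟩
  | in_new _ ih =>
    obtain ⟨α, hα, h⟩ := ih hM
    exact ⟨α, hα, .in_new h⟩
  | in_lamBang _ ih =>
    obtain ⟨α, hα, h⟩ := ih hM
    exact ⟨α, hα, .in_lamBang h⟩
  | in_lam k _ ih =>
    obtain ⟨α, hα, h⟩ := ih hM
    exact ⟨α, hα, .in_lam k h⟩

/-- Classical reduction of terms in finitely many steps. -/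
abbrev TSteps : Term → Term → Prop := Relation.ReflTransGen TStep

theorem reduces_ofTerm_iff (U : ℕ → Σ n, Gate n) (M : Term) (Q : Hilb M.qvars) (C : PreConfig) :
    Reduces U classical (.ofTerm M Q) C ↔ C = ⟨M.qvars, Q, C.term⟩ ∧ TSteps M C.term := by
  constructor
  · intro h
    induction h with
    | refl => exact ⟨rfl, .refl⟩
    | tail _ h ih =>
      obtain ⟨α, hα, h⟩ := h
      obtain ⟨M', hM', h⟩ := h.tStep hα
      obtain ⟨ih, ih'⟩ := ih
      rw [ih] at hM'
      rw [hM']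
      exact ⟨rfl, ih'.tail h⟩
  · rintro ⟨hC, h⟩
    rw [hC]
    generalize C.term = N at h
    suffices h' : Reduces U classical (.ofTerm M Q) ⟨M.qvars, Q, N⟩ ∧ N.qvars ⊆ M.qvars from h'.1
    induction h with
    | refl => exact ⟨.refl, le_rfl⟩
    | tail _ h ih => exact ⟨ih.1.tail (h.stepIn U Q ih.2), h.qvars_subset.trans ih.2⟩

theorem exists_reduces_iff (U : ℕ → Σ n, Gate n) (M N : Term) (Q : Hilb M.qvars) :
    (∃ C, Reduces U classical (.ofTerm M Q) C ∧ C.term = N) ↔ TSteps M N := by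
  constructor
  · rintro ⟨C, h, rfl⟩
    exact ((reduces_ofTerm_iff U M Q C).1 h).2
  · intro h
    exact ⟨⟨M.qvars, Q, N⟩, (reduces_ofTerm_iff U M Q _).2 ⟨rfl, h⟩, rfl⟩

/-- The gates and the register disappear from the problem here. One register is as good as any
other, and the zero function serves as a witness. -/
theorem represents_iff (U : ℕ → Σ n, Gate n) (M : Term) {n : ℕ} (f : List.Vector ℕ n →. ℕ) :
    Represents U M f ↔ ∀ v : List.Vector ℕ n,
      (∀ N, TSteps (M.appNums v) N → (∀ N', ¬ TStep N N') → ∃ m, N = num m) ∧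
      ∀ m, TSteps (M.appNums v) (num m) ↔ m ∈ f v := by
  simp only [Represents, exists_reduces_iff]
  refine forall_congr' fun v => ⟨fun h => ⟨fun N hN hN' => ?_, (h fun _ => 0).2⟩,
    fun h Q => ⟨fun C hC hC' => ?_, h.2⟩⟩
  · refine (h fun _ => 0).1 ⟨_, fun _ => 0, N⟩ ((reduces_ofTerm_iff U _ _ _).2 ⟨rfl, hN⟩) ?_
    rintro C ⟨α, hα, hC⟩
    obtain ⟨N', -, h'⟩ := hC.tStep hα
    exact hN' N' h'
  · obtain ⟨hC₁, hC₂⟩ := (reduces_ofTerm_iff U _ _ _).1 hC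
    refine h.1 C.term hC₂ fun N' hN' => hC' ⟨_, Q, N'⟩ ?_
    rw [hC₁]
    refine hN'.stepIn U Q ?_
    clear hC hC' hC₁ hN'
    generalize C.term = N at hC₂
    induction hC₂ with
    | refl => exact le_rfl
    | tail _ h ih => exact h.qvars_subset.trans ih

/-! ### Predicates defined by finitely many Horn clauses are recursively enumerable -/

/-- Arithmetical expressions built from pairing and addition. -/
inductive Pat : Type
  | var (i : ℕ)
  | const (n : ℕ)
  | pair (p q : Pat)
  | add (p q : Pat)

namespace Pat

/-- The value of an expression for an assignment of the variables. -/
def eval (e : List ℕ) : Pat → ℕ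
  | var i => e.getD i 0
  | const n => n
  | pair p q => Nat.pair (p.eval e) (q.eval e)
  | add p q => p.eval e + q.eval e

theorem primrec_eval (p : Pat) : Primrec fun e => p.eval e := by
  induction p with
  | var i => exact (Primrec.list_getD 0).comp .id (.const i)
  | const n => exact .const n
  | pair p q hp hq => exact Primrec₂.natPair.comp hp hq
  | add p q hp hq => exact Primrec.nat_add.comp hp hq

theorem primrec_map_eval (l : List Pat) : Primrec fun e => l.map (Pat.eval e) := by
  induction l with
  | nil => exact .const []
  | cons p l ih => exact Primrec.list_cons.comp p.primrec_eval ih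

end Pat

/-- A Horn clause: its premises and its conclusion, which are tuples of expressions. -/
abbrev Clause : Type := List (List Pat) × List Pat

/-- The facts that can be derived from a set of Horn clauses. -/
inductive Der (P : List Clause) : List ℕ → Prop
  | mk (r : Clause) (hr : r ∈ P) (e : List ℕ) (h : ∀ p ∈ r.1, Der P (p.map (Pat.eval e))) :
      Der P (r.2.map (Pat.eval e))

namespace Clause

/-- Add the conclusion of an instance of a clause to a list of facts that contains the premises. -/
def fire (r : Clause) (e : List ℕ) (s : List (List ℕ)) : List (List ℕ) :=
  if ∀ p ∈ r.1, p.map (Pat.eval e) ∈ s then r.2.map (Pat.eval e) :: s else s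

/-- Fire all the clauses in a list once. -/
def fireAll (P : List Clause) (e : List ℕ) (s : List (List ℕ)) : List (List ℕ) :=
  P.foldr (fun r s => fire r e s) s

/-- The facts obtained by firing all the clauses for a list of assignments. -/
def run (P : List Clause) (l : List (List ℕ)) : List (List ℕ) :=
  l.foldr (fireAll P) []

theorem primrecPred_mem_list {α : Type*} [Primcodable α] [DecidableEq α] :
    PrimrecPred fun x : α × List α => x.1 ∈ x.2 :=
  (Primrec.nat_lt.comp (Primrec.list_idxOf.comp .fst .snd)
    (Primrec.list_length.comp .snd)).of_eq fun _ => List.idxOf_lt_length_iff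

theorem primrec_fire (r : Clause) : Primrec₂ (fire r) := by
  refine Primrec.ite ?_ (Primrec.list_cons.comp ((Pat.primrec_map_eval r.2).comp .fst) .snd) .snd
  generalize r.1 = l
  induction l with
  | nil =>
    have h : PrimrecPred fun _ : List ℕ × List (List ℕ) => (0 : ℕ) = 0 :=
      Primrec.eq.comp (.const 0) (.const 0)
    exact h.of_eq fun _ => by simp
  | cons p l ih =>
    refine (PrimrecPred.and (primrecPred_mem_list.comp
      (Primrec.pair ((Pat.primrec_map_eval p).comp .fst) .snd)) ih).of_eq fun x => ?_
    simp

theorem primrec_fireAll (P : List Clause) : Primrec₂ (fireAll P) := by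
  induction P with
  | nil => exact .snd
  | cons r P ih => exact (primrec_fire r).comp .fst ih

theorem primrec_run (P : List Clause) : Primrec (run P) :=
  Primrec.list_foldr (h := fun _ x => fireAll P x.1 x.2) .id (.const [])
    ((primrec_fireAll P).comp (Primrec.fst.comp .snd) (Primrec.snd.comp .snd))

theorem subset_fire (r : Clause) (e : List ℕ) (s : List (List ℕ)) : s ⊆ fire r e s := by
  unfold fire
  split_ifs <;> simp

theorem fire_mono (r : Clause) (e : List ℕ) {s s' : List (List ℕ)} (h : s ⊆ s') :
    fire r e s ⊆ fire r e s' := by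
  by_cases hs : ∀ p ∈ r.1, p.map (Pat.eval e) ∈ s
  · rw [fire, fire, if_pos hs, if_pos fun p hp => h (hs p hp)]
    exact List.cons_subset_cons _ h
  · rw [fire, if_neg hs]
    exact List.Subset.trans h (subset_fire r e s')

theorem subset_fireAll (P : List Clause) (e : List ℕ) (s : List (List ℕ)) : s ⊆ fireAll P e s := by
  induction P with
  | nil => exact fun _ h => h
  | cons r P ih => exact List.Subset.trans ih (subset_fire r e _)

theorem fireAll_mono (P : List Clause) (e : List ℕ) {s s' : List (List ℕ)} (h : s ⊆ s') :
    fireAll P e s ⊆ fireAll P e s' := by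
  induction P with
  | nil => exact h
  | cons r P ih => exact fire_mono r e ih

theorem run_subset_append_right (P : List Clause) (l l' : List (List ℕ)) :
    run P l' ⊆ run P (l ++ l') := by
  induction l with
  | nil => exact fun _ h => h
  | cons e l ih => exact List.Subset.trans ih (subset_fireAll P e _)

theorem run_subset_append_left (P : List Clause) (l l' : List (List ℕ)) :
    run P l ⊆ run P (l ++ l') := by
  induction l with
  | nil => simp [run]
  | cons e l ih => exact fireAll_mono P e ih

theorem mem_fireAll {P : List Clause} {r : Clause} (hr : r ∈ P) {e : List ℕ} {s : List (List ℕ)}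
    (h : ∀ p ∈ r.1, p.map (Pat.eval e) ∈ s) : r.2.map (Pat.eval e) ∈ fireAll P e s := by
  induction P with
  | nil => simp at hr
  | cons r' P ih =>
    rcases List.mem_cons.1 hr with rfl | hr
    · change _ ∈ fire r e (fireAll P e s)
      rw [fire, if_pos fun p hp => subset_fireAll P e s (h p hp)]
      simp
    · exact subset_fire r' e _ (ih hr)

theorem der_of_mem_run {P : List Clause} {l : List (List ℕ)} :
    ∀ x ∈ run P l, Der P x := by
  induction l with
  | nil => simp [run]
  | cons e l ih =>
    suffices h : ∀ P' ⊆ P, ∀ x ∈ fireAll P' e (run P l), Der P x from h P fun _ h => h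
    intro P' hP'
    induction P' with
    | nil => exact ih
    | cons r P' ih' =>
      rw [List.cons_subset] at hP'
      intro x hx
      change x ∈ fire r e (fireAll P' e (run P l)) at hx
      unfold fire at hx
      split_ifs at hx with h
      · rcases List.mem_cons.1 hx with rfl | hx
        · exact .mk r hP'.1 e fun p hp => ih' hP'.2 _ (h p hp)
        · exact ih' hP'.2 x hx
      · exact ih' hP'.2 x hx

/-- A derivation uses finitely many instances of clauses, and listing their assignments gives a run
that replays it. Runs for the premises can be concatenated because firing is monotone. As `run`
folds from the right, the assignment put in front is fired last, when the premises are already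
present. -/
theorem der_iff_exists_mem_run {P : List Clause} {x : List ℕ} :
    Der P x ↔ ∃ l, x ∈ run P l := by
  refine ⟨fun h => ?_, fun ⟨l, h⟩ => der_of_mem_run x h⟩
  induction h with
  | mk r hr e _ ih =>
    obtain ⟨l, hl⟩ : ∃ l, ∀ p ∈ r.1, p.map (Pat.eval e) ∈ run P l := by
      generalize r.1 = ps at ih
      induction ps with
      | nil => exact ⟨[], by simp⟩
      | cons p ps ih' =>
        obtain ⟨l, hl⟩ := ih p (by simp)
        obtain ⟨l', hl'⟩ := ih' fun q hq => ih q (by simp [hq])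
        refine ⟨l ++ l', fun q hq => ?_⟩
        rcases List.mem_cons.1 hq with rfl | hq
        · exact run_subset_append_left P l l' hl
        · exact run_subset_append_right P l l' (hl' q hq)
    exact ⟨e :: l, mem_fireAll hr hl⟩

end Clause

/-- One search through the codes of pairs of a candidate value and a run. Checking a pair is
primitive recursive, and as `f a` has at most one value, whichever pair is found first carries the
right one. -/
theorem partrec_of_mem_iff_der {α : Type*} [Primcodable α] (P : List Clause) {f : α →. ℕ}
    {g : α → ℕ → List ℕ} (hg : Primrec₂ g) (h : ∀ a m, m ∈ f a ↔ Der P (g a m)) : Partrec f := by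
  let c : α → ℕ × List (List ℕ) → Option ℕ := fun a x =>
    if g a x.1 ∈ Clause.run P x.2 then some x.1 else none
  have hc : Primrec₂ c := by
    refine Primrec.ite ?_ (Primrec.option_some.comp (Primrec.fst.comp .snd)) (.const none)
    exact Clause.primrecPred_mem_list.comp (Primrec.pair (hg.comp .fst (Primrec.fst.comp .snd))
      ((Clause.primrec_run P).comp (Primrec.snd.comp .snd)))
  let d : α → ℕ → Option ℕ := fun a k =>
    (Encodable.decode (α := ℕ × List (List ℕ)) k).bind (c a)
  have hd : Primrec₂ d :=
    Primrec.option_bind (Primrec.decode.comp .snd) (hc.comp (Primrec.fst.comp .fst) .snd)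
  have hmem : ∀ a m, m ∈ f a ↔ ∃ k, m ∈ d a k := by
    intro a m
    rw [h, Clause.der_iff_exists_mem_run]
    constructor
    · rintro ⟨l, hl⟩
      exact ⟨Encodable.encode (m, l), by simp [d, c, hl]⟩
    · rintro ⟨k, hk⟩
      obtain ⟨x, -, hx⟩ := Option.bind_eq_some_iff.1 hk
      by_cases hx' : g a x.1 ∈ Clause.run P x.2
      · simp only [c, hx', if_true, Option.some.injEq] at hx
        exact ⟨x.2, hx ▸ hx'⟩
      · simp [c, hx'] at hx
  refine (Partrec.rfindOpt hd.to_comp).of_eq fun a => Part.ext fun m => ?_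
  refine ⟨fun hm => (hmem a m).2 (Nat.rfindOpt_spec hm), fun hm => ?_⟩
  obtain ⟨k, hk⟩ := (hmem a m).1 hm
  have hdom := Nat.rfindOpt_dom.2 ⟨k, m, hk⟩
  obtain ⟨k', hk'⟩ := Nat.rfindOpt_spec ⟨hdom, rfl⟩
  rw [Part.mem_unique hm ((hmem a _).2 ⟨k', hk'⟩)]
  exact Part.get_mem hdom

/-! ### Classical reduction is recursively enumerable -/

/-- The code of a variable. -/
def varCode (i : ℕ) : ℕ := Nat.pair 0 i

/-- The code of a term of the form `!M`. -/
def bangCode (a : ℕ) : ℕ := Nat.pair 2 a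

/-- The code of a term with head symbol `h`, which binds `b` variables in the list `l` of its
immediate subterms. -/
def nodeCode (h b l : ℕ) : ℕ := Nat.pair 1 (Nat.pair h (Nat.pair b l))

/-- The code of a nonempty list. -/
def consCode (a l : ℕ) : ℕ := Nat.pair 1 (Nat.pair a l)

/-- The code of a list. -/
def listCode : List ℕ → ℕ
  | [] => Nat.pair 0 0
  | a :: l => consCode a (listCode l)

/-- The code of a term. -/
def Term.code : Term → ℕ
  | var i => varCode i
  | qvar r => nodeCode (Nat.pair 0 r) 0 (listCode [])
  | bang M => bangCode M.code
  | bool b => nodeCode (Nat.pair 1 b.toNat) 0 (listCode [])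
  | unitary i => nodeCode (Nat.pair 2 i) 0 (listCode [])
  | new M => nodeCode (Nat.pair 3 0) 0 (listCode [M.code])
  | app M N => nodeCode (Nat.pair 4 0) 0 (listCode [M.code, N.code])
  | tuple _ M => nodeCode (Nat.pair 5 0) 0 (listCode (List.ofFn fun i => (M i).code))
  | lamBang M => nodeCode (Nat.pair 6 0) 1 (listCode [M.code])
  | lam k M => nodeCode (Nat.pair 7 k) (k + 1) (listCode [M.code])

theorem listCode_injective : Function.Injective listCode := by
  intro l
  induction l with
  | nil => rintro (_ | ⟨b, l'⟩) <;> simp [listCode, consCode]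
  | cons a l ih =>
    rintro (_ | ⟨b, l'⟩)
    · simp [listCode, consCode]
    · simp only [listCode, consCode, Nat.pair_eq_pair, true_and, List.cons.injEq]
      exact fun h => ⟨h.1, ih h.2⟩

theorem Term.code_injective : Function.Injective code := by
  intro M
  induction M with
  | var i => intro N; cases N <;> simp [code, varCode, bangCode, nodeCode]
  | qvar r => intro N; cases N <;> simp [code, varCode, bangCode, nodeCode]
  | bool b =>
    intro N
    cases N <;> simp [code, varCode, bangCode, nodeCode]
    rename_i b'
    revert b b'
    decide
  | unitary i => intro N; cases N <;> simp [code, varCode, bangCode, nodeCode]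
  | bang M ih =>
    intro N
    cases N <;> simp [code, varCode, bangCode, nodeCode]
    exact @ih _
  | new M ih =>
    intro N
    cases N <;> simp [code, varCode, bangCode, nodeCode, listCode_injective.eq_iff]
    exact @ih _
  | app M N ihM ihN =>
    intro N
    cases N <;> simp [code, varCode, bangCode, nodeCode, listCode_injective.eq_iff]
    exact fun h h' => ⟨ihM h, ihN h'⟩
  | tuple n M ih =>
    intro N
    cases N <;> simp [code, varCode, bangCode, nodeCode, listCode_injective.eq_iff,
      -List.ofFn_succ]
    rename_i m N
    intro h
    obtain rfl : n = m := by simpa using congrArg List.length h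
    refine ⟨rfl, heq_of_eq (funext fun i => ih i (congrFun (List.ofFn_injective h) i))⟩
  | lamBang M ih =>
    intro N
    cases N <;> simp [code, varCode, bangCode, nodeCode, listCode_injective.eq_iff]
    exact @ih _
  | lam k M ih =>
    intro N
    cases N <;> simp [code, varCode, bangCode, nodeCode, listCode_injective.eq_iff]
    exact fun h h' => ⟨h, ih h'⟩

theorem listCode_tuple {n : ℕ} (M : Fin n → Term) :
    listCode (List.ofFn fun i => (M i).code) = listCode ((List.ofFn M).map code) := by
  rw [List.map_ofFn]
  rfl

theorem ofFn_update {α : Type*} {n : ℕ} (M : Fin n → α) (i : Fin n) (a : α) :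
    List.ofFn (Function.update M i a) = (List.ofFn M).set i a := by
  refine List.ext_getElem (by simp) fun j h₁ h₂ => ?_
  simp only [List.length_ofFn] at h₁
  by_cases h : (i : ℕ) = j
  · subst h
    simp
  · have h' : (⟨j, h₁⟩ : Fin n) ≠ i := fun h' => h (by rw [← h'])
    simp [h, h']

/-- Raise by `k` the indices that are at least `c`. -/
def Term.shiftAt (c k : ℕ) (M : Term) : Term := M.rename (liftRen c fun i => i + k)

/-- Substitute `N` for the variable with index `c`. -/
def Term.substAt (c : ℕ) (N M : Term) : Term := M.subst (liftSub c (single N))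

theorem Term.shiftAt_zero (k : ℕ) (M : Term) : M.shiftAt 0 k = M.shift k := by
  simp only [shiftAt, shift]
  congr 1

theorem Term.substAt_zero (N M : Term) : substAt 0 N M = M.subst (single N) := by
  simp only [substAt]
  congr 1
  funext i
  simpa [liftSub, shift] using (rename_eq_subst (single N i) _).trans (subst_var _)

/-- The immediate subterms of a term whose code is a node. -/
theorem Term.exists_children {M : Term} {h b l : ℕ} (hM : M.code = nodeCode h b l) :
    ∃ (Ms : List Term) (mk : List Term → Term), l = listCode (Ms.map code) ∧
      (∀ Ns : List Term, Ns.length = Ms.length →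
        (mk Ns).code = nodeCode h b (listCode (Ns.map code))) ∧
      (∀ c k, M.shiftAt c k = mk (Ms.map (shiftAt (c + b) k))) ∧
      (∀ c N, substAt c N M = mk (Ms.map (substAt (c + b) N))) ∧
      ∀ i N, (∃ hi : i < Ms.length, TStep Ms[i] N) → TStep M (mk (Ms.set i N)) := by
  cases M with
  | var | bang => simp [code, nodeCode, varCode, bangCode] at hM
  | qvar | bool | unitary =>
    simp only [code, nodeCode, Nat.pair_eq_pair, true_and] at hM
    obtain ⟨rfl, rfl, rfl⟩ := hM
    refine ⟨[], fun _ => _, rfl, fun Ns hNs => ?_, fun _ _ => rfl, fun _ _ => rfl, by simp⟩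
    rw [List.length_eq_zero_iff.1 hNs]
    rfl
  | new M =>
    simp only [code, nodeCode, Nat.pair_eq_pair, true_and] at hM
    obtain ⟨rfl, rfl, rfl⟩ := hM
    -- The default `var 0` is never read: `mk` is only applied to lists as long as the list of
    -- subterms.
    refine ⟨[M], fun Ns => new (Ns.getD 0 (var 0)), rfl, fun Ns hNs => ?_, fun _ _ => rfl,
      fun _ _ => rfl, ?_⟩
    · obtain ⟨N, rfl⟩ := List.length_eq_one_iff.1 hNs
      rfl
    · rintro i N ⟨hi, hN⟩
      obtain rfl : i = 0 := by simpa using hi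
      exact .in_new hN
  | app M N =>
    simp only [code, nodeCode, Nat.pair_eq_pair, true_and] at hM
    obtain ⟨rfl, rfl, rfl⟩ := hM
    refine ⟨[M, N], fun Ns => app (Ns.getD 0 (var 0)) (Ns.getD 1 (var 0)), rfl,
      fun Ns hNs => ?_, fun _ _ => rfl, fun _ _ => rfl, ?_⟩
    · obtain ⟨N, N', rfl⟩ := List.length_eq_two.1 hNs
      rfl
    · rintro i N ⟨hi, hN⟩
      obtain rfl | rfl : i = 0 ∨ i = 1 := by
        simp only [List.length_cons, List.length_nil] at hi
        omega
      · exact .app_left hN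
      · exact .app_right hN
  | tuple n M =>
    simp only [code, nodeCode, Nat.pair_eq_pair, true_and] at hM
    obtain ⟨rfl, rfl, rfl⟩ := hM
    refine ⟨List.ofFn M, fun Ns => tuple n fun i => Ns.getD i (var 0), listCode_tuple M,
      fun Ns hNs => ?_, fun c k => ?_, fun c N => ?_, ?_⟩
    · simp only [List.length_ofFn] at hNs
      simp only [code]
      congr 2
      refine List.ext_getElem (by simp [hNs]) fun j h₁ h₂ => ?_
      simp only [List.length_ofFn] at h₁
      simp [-List.ofFn_succ, List.getElem?_eq_getElem (hNs ▸ h₁ : j < Ns.length)]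
    · simp [shiftAt, rename, -List.ofFn_succ]
    · simp [substAt, subst, -List.ofFn_succ]
    · rintro i N ⟨hi, hN⟩
      simp only [List.length_ofFn] at hi
      simp only [List.getElem_ofFn] at hN
      convert TStep.tuple n M ⟨i, hi⟩ N hN with j
      rw [← ofFn_update M ⟨i, hi⟩ N]
      simp [-List.ofFn_succ]
  | lamBang M =>
    simp only [code, nodeCode, Nat.pair_eq_pair, true_and] at hM
    obtain ⟨rfl, rfl, rfl⟩ := hM
    refine ⟨[M], fun Ns => lamBang (Ns.getD 0 (var 0)), rfl, fun Ns hNs => ?_, fun c k => ?_,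
      fun c N => ?_, ?_⟩
    · obtain ⟨N, rfl⟩ := List.length_eq_one_iff.1 hNs
      rfl
    · simp [shiftAt, rename, liftRen_liftRen]
    · simp [substAt, subst, liftSub_liftSub]
    · rintro i N ⟨hi, hN⟩
      obtain rfl : i = 0 := by simpa using hi
      exact .in_lamBang hN
  | lam k M =>
    simp only [code, nodeCode, Nat.pair_eq_pair, true_and] at hM
    obtain ⟨rfl, rfl, rfl⟩ := hM
    refine ⟨[M], fun Ns => lam k (Ns.getD 0 (var 0)), rfl, fun Ns hNs => ?_, fun c k => ?_,
      fun c N => ?_, ?_⟩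
    · obtain ⟨N, rfl⟩ := List.length_eq_one_iff.1 hNs
      rfl
    · simp [shiftAt, rename, liftRen_liftRen]
    · simp [substAt, subst, liftSub_liftSub]
    · rintro i N ⟨hi, hN⟩
      obtain rfl : i = 0 := by simpa using hi
      exact .in_lam k hN

namespace Pat

/-- The expression for the code of a variable. -/
def varP (i : Pat) : Pat := pair (const 0) i

/-- The expression for the code of a term of the form `!M`. -/
def bangP (a : Pat) : Pat := pair (const 2) a

/-- The expression for the code of a term with a head symbol. -/
def nodeP (h b l : Pat) : Pat := pair (const 1) (pair h (pair b l))

/-- The expression for the code of the empty list. -/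
def nilP : Pat := pair (const 0) (const 0)

/-- The expression for the code of a nonempty list. -/
def consP (a l : Pat) : Pat := pair (const 1) (pair a l)

/-- The expression for the code of an application. -/
def appP (a b : Pat) : Pat := nodeP (pair (const 4) (const 0)) (const 0) (consP a (consP b nilP))

/-- The expression for the code of `λ!x.M`. -/
def lamBangP (a : Pat) : Pat := nodeP (pair (const 6) (const 0)) (const 1) (consP a nilP)

/-- The expression for the code of `λπ.M`. -/
def lamP (k a : Pat) : Pat := nodeP (pair (const 7) k) (add k (const 1)) (consP a nilP)

end Pat

open Pat in
/-- Clauses for classical reduction. The first component of a fact says what it states: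
`0` is `shiftAt`, `2` is `substAt`, and `4` is one step of reduction; `1`, `3` and `5` are the same
for lists of terms; `6` is reduction in finitely many steps. -/
def clauses : List Clause :=
  let x := Pat.var
  [([], [const 0, add (add (x 0) (x 1)) (const 1), x 2, varP (x 0), varP (x 0)]),
   ([], [const 0, x 0, x 2, varP (add (x 0) (x 1)), varP (add (add (x 0) (x 1)) (x 2))]),
   ([[const 0, x 0, x 1, x 2, x 3]], [const 0, x 0, x 1, bangP (x 2), bangP (x 3)]),
   ([[const 1, add (x 0) (x 3), x 1, x 4, x 5]],
     [const 0, x 0, x 1, nodeP (x 2) (x 3) (x 4), nodeP (x 2) (x 3) (x 5)]),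
   ([], [const 1, x 0, x 1, nilP, nilP]),
   ([[const 0, x 0, x 1, x 2, x 3], [const 1, x 0, x 1, x 4, x 5]],
     [const 1, x 0, x 1, consP (x 2) (x 4), consP (x 3) (x 5)]),
   ([], [const 2, add (add (x 0) (x 1)) (const 1), x 2, varP (x 0), varP (x 0)]),
   ([[const 0, const 0, x 0, x 1, x 2]], [const 2, x 0, x 1, varP (x 0), x 2]),
   ([], [const 2, x 0, x 2, varP (add (add (x 0) (x 1)) (const 1)), varP (add (x 0) (x 1))]),
   ([[const 2, x 0, x 1, x 2, x 3]], [const 2, x 0, x 1, bangP (x 2), bangP (x 3)]),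
   ([[const 3, add (x 0) (x 3), x 1, x 4, x 5]],
     [const 2, x 0, x 1, nodeP (x 2) (x 3) (x 4), nodeP (x 2) (x 3) (x 5)]),
   ([], [const 3, x 0, x 1, nilP, nilP]),
   ([[const 2, x 0, x 1, x 2, x 3], [const 3, x 0, x 1, x 4, x 5]],
     [const 3, x 0, x 1, consP (x 2) (x 4), consP (x 3) (x 5)]),
   ([[const 2, const 0, x 1, x 0, x 2]], [const 4, appP (lamP (const 0) (x 0)) (x 1), x 2]),
   ([[const 2, const 0, x 1, x 0, x 2]], [const 4, appP (lamBangP (x 0)) (bangP (x 1)), x 2]),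
   ([[const 0, const 0, add (x 0) (const 1), x 1, x 4]],
     [const 4, appP (x 1) (appP (lamP (x 0) (x 2)) (x 3)),
       appP (lamP (x 0) (appP (x 4) (x 2))) (x 3)]),
   ([[const 0, const 0, add (x 0) (const 1), x 1, x 4]],
     [const 4, appP (appP (lamP (x 0) (x 2)) (x 3)) (x 1),
       appP (lamP (x 0) (appP (x 2) (x 4))) (x 3)]),
   ([[const 5, x 2, x 3]],
     [const 4, nodeP (x 0) (x 1) (x 2), nodeP (x 0) (x 1) (x 3)]),
   ([[const 4, x 0, x 1]], [const 5, consP (x 0) (x 2), consP (x 1) (x 2)]),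
   ([[const 5, x 1, x 2]], [const 5, consP (x 0) (x 1), consP (x 0) (x 2)]),
   ([], [const 6, x 0, x 0]),
   ([[const 4, x 0, x 1], [const 6, x 1, x 2]], [const 6, x 0, x 2])]

/-- What a fact states. -/
def Holds : List ℕ → Prop
  | [0, c, k, a, a'] => ∀ M, a = code M → a' = (M.shiftAt c k).code
  | [1, c, k, l, l'] => ∀ Ms : List Term, l = listCode (Ms.map code) →
      l' = listCode ((Ms.map (shiftAt c k)).map code)
  | [2, c, b, a, a'] => ∀ M N, a = code M → b = code N → a' = (substAt c N M).code
  | [3, c, b, l, l'] => ∀ (Ms : List Term) N, l = listCode (Ms.map code) → b = code N →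
      l' = listCode ((Ms.map (substAt c N)).map code)
  | [4, a, a'] => ∀ M, a = code M → ∃ M', a' = code M' ∧ TStep M M'
  | [5, l, l'] => ∀ Ms : List Term, l = listCode (Ms.map code) →
      ∃ i N, l' = listCode ((Ms.set i N).map code) ∧ ∃ hi : i < Ms.length, TStep Ms[i] N
  | [6, a, a'] => ∀ M, a = code M → ∃ M', a' = code M' ∧ TSteps M M'
  | _ => True

/-! ### Decoding, and soundness of the clauses for reduction -/

theorem Term.eq_var_of_code {M : Term} {i : ℕ} (h : varCode i = M.code) : M = var i :=
  (code_injective (a₁ := var i) h).symm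

theorem Term.exists_eq_bang_of_code {M : Term} {a : ℕ} (h : bangCode a = M.code) :
    ∃ N, M = bang N ∧ a = N.code := by
  cases M <;> simp [code, varCode, bangCode, nodeCode] at h
  exact ⟨_, rfl, h⟩

theorem Term.exists_eq_app_of_code {M : Term} {a b : ℕ}
    (h : nodeCode (Nat.pair 4 0) 0 (consCode a (consCode b (Nat.pair 0 0))) = M.code) :
    ∃ N N', M = app N N' ∧ a = N.code ∧ b = N'.code := by
  cases M <;> simp [code, varCode, bangCode, nodeCode, listCode, consCode] at h
  exact ⟨_, _, rfl, h⟩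

theorem Term.exists_eq_lamBang_of_code {M : Term} {a : ℕ}
    (h : nodeCode (Nat.pair 6 0) 1 (consCode a (Nat.pair 0 0)) = M.code) :
    ∃ N, M = lamBang N ∧ a = N.code := by
  cases M <;> simp [code, varCode, bangCode, nodeCode, listCode, consCode] at h
  exact ⟨_, rfl, h⟩

theorem Term.exists_eq_lam_of_code {M : Term} {k a : ℕ}
    (h : nodeCode (Nat.pair 7 k) (k + 1) (consCode a (Nat.pair 0 0)) = M.code) :
    ∃ N, M = lam k N ∧ a = N.code := by
  cases M <;> simp [code, varCode, bangCode, nodeCode, listCode, consCode] at h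
  exact ⟨_, by rw [h.1], h.2⟩

theorem exists_eq_cons_of_listCode {Ms : List Term} {a l : ℕ}
    (h : consCode a l = listCode (Ms.map code)) :
    ∃ M Ms', Ms = M :: Ms' ∧ a = M.code ∧ l = listCode (Ms'.map code) := by
  cases Ms <;> simp [listCode, consCode] at h
  exact ⟨_, _, rfl, h⟩

theorem eq_nil_of_listCode {Ms : List Term}
    (h : Nat.pair 0 0 = listCode (Ms.map code)) : Ms = [] := by
  cases Ms <;> simp [listCode, consCode] at h
  rfl

namespace Pat

variable (e : List ℕ) (p q r : Pat)

theorem eval_varP : (varP p).eval e = varCode (p.eval e) := rfl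

theorem eval_bangP : (bangP p).eval e = bangCode (p.eval e) := rfl

theorem eval_nodeP : (nodeP p q r).eval e = nodeCode (p.eval e) (q.eval e) (r.eval e) := rfl

theorem eval_nilP : nilP.eval e = Nat.pair 0 0 := rfl

theorem eval_consP : (consP p q).eval e = consCode (p.eval e) (q.eval e) := rfl

end Pat

/-- Clauses may be instantiated with numbers that code no term. `Holds` is therefore conditional on
its inputs being codes, and such instances are vacuously sound. One case per clause, with
`exists_children` treating all head symbols alike. -/
theorem holds_of_der {x : List ℕ} (h : Der clauses x) : Holds x := by
  induction h with
  | mk r hr e _ ih =>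
    simp only [clauses, List.mem_cons, List.not_mem_nil, or_false] at hr
    rcases hr with rfl | rfl | rfl | rfl | rfl | rfl | rfl | rfl | rfl | rfl | rfl | rfl | rfl |
        rfl | rfl | rfl | rfl | rfl | rfl | rfl | rfl | rfl <;>
      simp only [List.mem_cons, List.not_mem_nil, or_false, forall_eq_or_imp, forall_eq,
        List.map_cons, List.map_nil, Pat.eval, Pat.eval_varP, Pat.eval_bangP, Pat.eval_nodeP,
        Pat.eval_nilP, Pat.eval_consP, Pat.appP, Pat.lamP, Pat.lamBangP, Holds] at ih ⊢ <;>
      clear * -ih <;> revert ih <;>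
      generalize e.getD 0 0 = x₀, e.getD 1 0 = x₁, e.getD 2 0 = x₂, e.getD 3 0 = x₃,
        e.getD 4 0 = x₄, e.getD 5 0 = x₅ <;> intro ih
    · intro M h
      rw [eq_var_of_code h]
      simp [shiftAt, rename, liftRen, code, show x₀ < x₀ + x₁ + 1 by omega]
    · intro M h
      rw [eq_var_of_code h]
      simp [shiftAt, rename, liftRen, code, add_comm, add_left_comm]
    · intro M h
      obtain ⟨N, rfl, hN⟩ := exists_eq_bang_of_code h
      rw [ih N hN]
      rfl
    · intro M h
      obtain ⟨Ms, mk, hl, hmk, hM, -, -⟩ := exists_children h.symm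
      rw [ih Ms hl, hM, hmk _ (by simp)]
    · intro Ms h
      rw [eq_nil_of_listCode h]
      rfl
    · intro Ms h
      obtain ⟨M, Ms', rfl, hM, hMs⟩ := exists_eq_cons_of_listCode h
      rw [ih.1 M hM, ih.2 Ms' hMs]
      rfl
    · intro M N h _
      rw [eq_var_of_code h]
      simp [substAt, subst, liftSub, code, show x₀ < x₀ + x₁ + 1 by omega]
    · intro M N h hN
      rw [eq_var_of_code h, ih N hN, shiftAt_zero]
      simp [substAt, subst, liftSub]
    · intro M N h _
      rw [eq_var_of_code h]
      simp [substAt, subst, liftSub, code, shift, rename, add_comm,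
        show x₀ + x₁ + 1 - x₀ = x₁ + 1 by omega, show ¬ x₀ + x₁ + 1 < x₀ by omega]
    · intro M N h hN
      obtain ⟨M', rfl, hM'⟩ := exists_eq_bang_of_code h
      rw [ih M' N hM' hN]
      rfl
    · intro M N h hN
      obtain ⟨Ms, mk, hl, hmk, -, hM, -⟩ := exists_children h.symm
      rw [ih Ms N hl hN, hM, hmk _ (by simp)]
    · intro Ms N h _
      rw [eq_nil_of_listCode h]
      rfl
    · intro Ms N h hN
      obtain ⟨M, Ms', rfl, hM, hMs⟩ := exists_eq_cons_of_listCode h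
      rw [ih.1 M N hM hN, ih.2 Ms' N hMs hN]
      rfl
    · intro M h
      obtain ⟨M₁, N, rfl, hM, hN⟩ := exists_eq_app_of_code h
      obtain ⟨M₂, rfl, hM₂⟩ := exists_eq_lam_of_code hM
      exact ⟨_, ih M₂ N hM₂ hN, substAt_zero N M₂ ▸ .lβ M₂ N⟩
    · intro M h
      obtain ⟨M₁, N, rfl, hM, hN⟩ := exists_eq_app_of_code h
      obtain ⟨M₂, rfl, hM₂⟩ := exists_eq_lamBang_of_code hM
      obtain ⟨N₂, rfl, hN₂⟩ := exists_eq_bang_of_code hN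
      exact ⟨_, ih M₂ N₂ hM₂ hN₂, substAt_zero N₂ M₂ ▸ .cβ M₂ N₂⟩
    · intro M h
      obtain ⟨L, M₁, rfl, hL, hM⟩ := exists_eq_app_of_code h
      obtain ⟨M₂, N, rfl, hM₂, hN⟩ := exists_eq_app_of_code hM
      obtain ⟨M₃, rfl, hM₃⟩ := exists_eq_lam_of_code hM₂
      refine ⟨app (lam x₀ (app (L.shift (x₀ + 1)) M₃)) N, ?_, .lcm x₀ L M₃ N⟩
      rw [ih L hL, shiftAt_zero, hM₃, hN]
      simp only [code, listCode]
    · intro M h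
      obtain ⟨M₁, L, rfl, hM, hL⟩ := exists_eq_app_of_code h
      obtain ⟨M₂, N, rfl, hM₂, hN⟩ := exists_eq_app_of_code hM
      obtain ⟨M₃, rfl, hM₃⟩ := exists_eq_lam_of_code hM₂
      refine ⟨app (lam x₀ (app M₃ (L.shift (x₀ + 1)))) N, ?_, .rcm x₀ L M₃ N⟩
      rw [ih L hL, shiftAt_zero, hM₃, hN]
      simp only [code, listCode]
    · intro M h
      obtain ⟨Ms, mk, hl, hmk, -, -, hM⟩ := exists_children h.symm
      obtain ⟨i, N, rfl, hN⟩ := ih Ms hl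
      exact ⟨_, (hmk _ (by simp)).symm, hM i N hN⟩
    · intro Ms h
      obtain ⟨M, Ms', rfl, hM, rfl⟩ := exists_eq_cons_of_listCode h
      obtain ⟨N, rfl, hN⟩ := ih M hM
      exact ⟨0, N, rfl, by simp, hN⟩
    · intro Ms h
      obtain ⟨M, Ms', rfl, rfl, hMs⟩ := exists_eq_cons_of_listCode h
      obtain ⟨i, N, rfl, hi, hN⟩ := ih Ms' hMs
      exact ⟨i + 1, N, rfl, by simpa using hi, hN⟩
    · intro M h
      exact ⟨M, h, .refl⟩
    · intro M h
      obtain ⟨M', h', hM⟩ := ih.1 M h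
      obtain ⟨N, hN, hM'⟩ := ih.2 M' h'
      exact ⟨N, hN, .head hM hM'⟩

/-! ### Completeness of the clauses for reduction -/

theorem der_clauses_intro (i : ℕ) (hi : i < clauses.length) (e : List ℕ)
    (h : ∀ p ∈ (clauses[i]).1, Der clauses (p.map (Pat.eval e))) :
    Der clauses ((clauses[i]).2.map (Pat.eval e)) :=
  .mk _ (List.getElem_mem hi) e h

theorem der_shiftAt_list {c k : ℕ} {Ms : List Term}
    (h : ∀ M ∈ Ms, Der clauses [0, c, k, M.code, (M.shiftAt c k).code]) :
    Der clauses [1, c, k, listCode (Ms.map code), listCode ((Ms.map (shiftAt c k)).map code)] := by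
  induction Ms with
  -- The numeral is the position of the clause in `clauses`, counted from `0`; the list gives the
  -- values of its variables.
  | nil => exact der_clauses_intro 4 (by decide) [c, k] (by simp [clauses])
  | cons M Ms ih =>
    simp only [List.mem_cons, forall_eq_or_imp] at h
    refine der_clauses_intro 5 (by decide) [c, k, M.code, (M.shiftAt c k).code,
      listCode (Ms.map code), listCode ((Ms.map (shiftAt c k)).map code)] ?_
    exact List.forall_mem_cons.2 ⟨h.1, List.forall_mem_cons.2 ⟨ih h.2, by simp⟩⟩

theorem der_substAt_list {c : ℕ} {N : Term} {Ms : List Term}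
    (h : ∀ M ∈ Ms, Der clauses [2, c, N.code, M.code, (substAt c N M).code]) :
    Der clauses
      [3, c, N.code, listCode (Ms.map code), listCode ((Ms.map (substAt c N)).map code)] := by
  induction Ms with
  | nil => exact der_clauses_intro 11 (by decide) [c, N.code] (by simp [clauses])
  | cons M Ms ih =>
    simp only [List.mem_cons, forall_eq_or_imp] at h
    refine der_clauses_intro 12 (by decide) [c, N.code, M.code, (substAt c N M).code,
      listCode (Ms.map code), listCode ((Ms.map (substAt c N)).map code)] ?_
    exact List.forall_mem_cons.2 ⟨h.1, List.forall_mem_cons.2 ⟨ih h.2, by simp⟩⟩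

theorem der_shiftAt_node {c k h b : ℕ} {Ms : List Term}
    (hMs : ∀ M ∈ Ms, Der clauses [0, c + b, k, M.code, (M.shiftAt (c + b) k).code]) :
    Der clauses [0, c, k, nodeCode h b (listCode (Ms.map code)),
      nodeCode h b (listCode ((Ms.map (shiftAt (c + b) k)).map code))] :=
  der_clauses_intro 3 (by decide) [c, k, h, b, listCode (Ms.map code),
    listCode ((Ms.map (shiftAt (c + b) k)).map code)]
    (List.forall_mem_cons.2 ⟨der_shiftAt_list hMs, by simp⟩)

theorem der_substAt_node {c h b : ℕ} {N : Term} {Ms : List Term}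
    (hMs : ∀ M ∈ Ms, Der clauses [2, c + b, N.code, M.code, (substAt (c + b) N M).code]) :
    Der clauses [2, c, N.code, nodeCode h b (listCode (Ms.map code)),
      nodeCode h b (listCode ((Ms.map (substAt (c + b) N)).map code))] :=
  der_clauses_intro 10 (by decide) [c, N.code, h, b, listCode (Ms.map code),
    listCode ((Ms.map (substAt (c + b) N)).map code)]
    (List.forall_mem_cons.2 ⟨der_substAt_list hMs, by simp⟩)

theorem der_shiftAt (c k : ℕ) (M : Term) :
    Der clauses [0, c, k, M.code, (M.shiftAt c k).code] := by
  induction M generalizing c with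
  | var i =>
    by_cases h : i < c
    -- Clauses have no side conditions, so `i < c` is expressed by writing `c` as `i + j + 1`.
    · obtain ⟨j, rfl⟩ := Nat.exists_eq_add_of_lt h
      have : Der clauses [0, i + j + 1, k, varCode i, varCode i] :=
        der_clauses_intro 0 (by decide) [i, j, k] (by simp [clauses])
      simpa [shiftAt, rename, liftRen, h, code] using this
    · obtain ⟨j, rfl⟩ := Nat.exists_eq_add_of_le (not_lt.1 h)
      have : Der clauses [0, c, k, varCode (c + j), varCode (c + j + k)] :=
        der_clauses_intro 1 (by decide) [c, j, k] (by simp [clauses])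
      simpa [shiftAt, rename, liftRen, code, show j + k + c = c + j + k by omega] using this
  | bang M ih =>
    exact der_clauses_intro 2 (by decide) [c, k, M.code, (M.shiftAt c k).code]
      (List.forall_mem_cons.2 ⟨ih c, by simp⟩)
  | qvar | bool | unitary => exact der_shiftAt_node (b := 0) (Ms := []) (by simp)
  | new M ih => exact der_shiftAt_node (b := 0) (Ms := [M]) (by simpa using ih c)
  | app M N ihM ihN =>
    exact der_shiftAt_node (b := 0) (Ms := [M, N]) (by simpa using ⟨ihM c, ihN c⟩)
  | tuple n M ih =>
    have := der_shiftAt_node (c := c) (k := k) (h := Nat.pair 5 0) (b := 0) (Ms := List.ofFn M)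
      (by simpa [-List.ofFn_succ, List.mem_ofFn] using fun i => ih i c)
    rw [← listCode_tuple, List.map_ofFn, ← listCode_tuple] at this
    exact this
  | lamBang M ih =>
    have := der_shiftAt_node (c := c) (k := k) (h := Nat.pair 6 0) (b := 1) (Ms := [M])
      (by simpa using ih (c + 1))
    simpa [shiftAt, rename, liftRen_liftRen, code] using this
  | lam l M ih =>
    have := der_shiftAt_node (c := c) (k := k) (h := Nat.pair 7 l) (b := l + 1) (Ms := [M])
      (by simpa using ih (c + (l + 1)))
    simpa [shiftAt, rename, liftRen_liftRen, code] using this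

theorem der_shift (k : ℕ) (M : Term) : Der clauses [0, 0, k, M.code, (M.shift k).code] :=
  shiftAt_zero k M ▸ der_shiftAt 0 k M

theorem der_substAt (c : ℕ) (N M : Term) :
    Der clauses [2, c, N.code, M.code, (substAt c N M).code] := by
  induction M generalizing c with
  | var i =>
    rcases lt_trichotomy i c with h | rfl | h
    · obtain ⟨j, rfl⟩ := Nat.exists_eq_add_of_lt h
      have : Der clauses [2, i + j + 1, N.code, varCode i, varCode i] :=
        der_clauses_intro 6 (by decide) [i, j, N.code] (by simp [clauses])
      simpa [substAt, subst, liftSub, h, code] using this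
    · have : Der clauses [2, i, N.code, varCode i, (N.shift i).code] :=
        der_clauses_intro 7 (by decide) [i, N.code, (N.shift i).code]
        (List.forall_mem_cons.2 ⟨der_shift i N, by simp⟩)
      simpa [substAt, subst, liftSub, code] using this
    · obtain ⟨j, rfl⟩ := Nat.exists_eq_add_of_lt h
      have : Der clauses [2, c, N.code, varCode (c + j + 1), varCode (c + j)] :=
        der_clauses_intro 8 (by decide) [c, j, N.code] (by simp [clauses])
      simpa [substAt, subst, liftSub, code, shift, rename, show c + j + 1 - c = j + 1 by omega,
        show ¬ c + j + 1 < c by omega, add_comm j c] using this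
  | bang M ih =>
    exact der_clauses_intro 9 (by decide) [c, N.code, M.code, (substAt c N M).code]
      (List.forall_mem_cons.2 ⟨ih c, by simp⟩)
  | qvar | bool | unitary => exact der_substAt_node (b := 0) (Ms := []) (by simp)
  | new M ih => exact der_substAt_node (b := 0) (Ms := [M]) (by simpa using ih c)
  | app M M' ihM ihN =>
    exact der_substAt_node (b := 0) (Ms := [M, M']) (by simpa using ⟨ihM c, ihN c⟩)
  | tuple n M ih =>
    have := der_substAt_node (c := c) (N := N) (h := Nat.pair 5 0) (b := 0) (Ms := List.ofFn M)
      (by simpa [-List.ofFn_succ, List.mem_ofFn] using fun i => ih i c)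
    rw [← listCode_tuple, List.map_ofFn, ← listCode_tuple] at this
    exact this
  | lamBang M ih =>
    have := der_substAt_node (c := c) (N := N) (h := Nat.pair 6 0) (b := 1) (Ms := [M])
      (by simpa using ih (c + 1))
    simpa [substAt, subst, liftSub_liftSub, code] using this
  | lam l M ih =>
    have := der_substAt_node (c := c) (N := N) (h := Nat.pair 7 l) (b := l + 1) (Ms := [M])
      (by simpa using ih (c + (l + 1)))
    simpa [substAt, subst, liftSub_liftSub, code] using this

theorem der_subst_single (N M : Term) :
    Der clauses [2, 0, N.code, M.code, (M.subst (single N)).code] :=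
  substAt_zero N M ▸ der_substAt 0 N M

theorem der_tStep_list {Ms : List Term} {i : ℕ} (hi : i < Ms.length) {N : Term}
    (h : Der clauses [4, Ms[i].code, N.code]) :
    Der clauses [5, listCode (Ms.map code), listCode ((Ms.set i N).map code)] := by
  induction Ms generalizing i with
  | nil => simp at hi
  | cons M Ms ih =>
    cases i with
    | zero =>
      exact der_clauses_intro 18 (by decide) [M.code, N.code, listCode (Ms.map code)]
        (List.forall_mem_cons.2 ⟨h, by simp⟩)
    | succ i =>
      simp only [List.length_cons, Nat.add_lt_add_iff_right] at hi
      exact der_clauses_intro 19 (by decide)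
        [M.code, listCode (Ms.map code), listCode ((Ms.set i N).map code)]
        (List.forall_mem_cons.2 ⟨ih hi h, by simp⟩)

theorem der_tStep_node (h b : ℕ) {Ms : List Term} {i : ℕ} (hi : i < Ms.length) {N : Term}
    (hN : Der clauses [4, Ms[i].code, N.code]) :
    Der clauses [4, nodeCode h b (listCode (Ms.map code)),
      nodeCode h b (listCode ((Ms.set i N).map code))] :=
  der_clauses_intro 17 (by decide)
    [h, b, listCode (Ms.map code), listCode ((Ms.set i N).map code)]
    (List.forall_mem_cons.2 ⟨der_tStep_list hi hN, by simp⟩)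

theorem TStep.der {M M' : Term} (h : TStep M M') : Der clauses [4, M.code, M'.code] := by
  induction h with
  | lβ M N =>
    exact der_clauses_intro 13 (by decide) [M.code, N.code, (M.subst (single N)).code]
      (List.forall_mem_cons.2 ⟨der_subst_single N M, by simp⟩)
  | cβ M N =>
    exact der_clauses_intro 14 (by decide) [M.code, N.code, (M.subst (single N)).code]
      (List.forall_mem_cons.2 ⟨der_subst_single N M, by simp⟩)
  | lcm k L M N =>
    exact der_clauses_intro 15 (by decide) [k, L.code, M.code, N.code, (L.shift (k + 1)).code]
      (List.forall_mem_cons.2 ⟨der_shift (k + 1) L, by simp⟩)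
  | rcm k L M N =>
    exact der_clauses_intro 16 (by decide) [k, L.code, M.code, N.code, (L.shift (k + 1)).code]
      (List.forall_mem_cons.2 ⟨der_shift (k + 1) L, by simp⟩)
  | tuple n M i M' _ ih =>
    have := der_tStep_node (Nat.pair 5 0) 0 (Ms := List.ofFn M) (i := i)
      (by rw [List.length_ofFn]; exact i.2) (N := M') (by simpa [-List.ofFn_succ] using ih)
    rw [← ofFn_update, ← listCode_tuple, ← listCode_tuple] at this
    exact this
  | @app_right M N N' _ ih =>
    exact der_tStep_node (Nat.pair 4 0) 0 (Ms := [M, N]) (i := 1) (by simp) ih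
  | @app_left M M' N _ ih =>
    exact der_tStep_node (Nat.pair 4 0) 0 (Ms := [M, N]) (i := 0) (by simp) ih
  | @in_new M M' _ ih =>
    exact der_tStep_node (Nat.pair 3 0) 0 (Ms := [M]) (i := 0) (by simp) ih
  | @in_lamBang M M' _ ih =>
    exact der_tStep_node (Nat.pair 6 0) 1 (Ms := [M]) (i := 0) (by simp) ih
  | @in_lam M M' k _ ih =>
    exact der_tStep_node (Nat.pair 7 k) (k + 1) (Ms := [M]) (i := 0) (by simp) ih

/-- Soundness only provides some reduct with the same code as `N`; injectivity of the coding
identifies it with `N`. -/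
theorem tSteps_iff_der {M N : Term} : TSteps M N ↔ Der clauses [6, M.code, N.code] := by
  constructor
  · intro h
    induction h using Relation.ReflTransGen.head_induction_on with
    | refl => exact der_clauses_intro 20 (by decide) [N.code] (by simp [clauses])
    | @head M M' h _ ih =>
      exact der_clauses_intro 21 (by decide) [M.code, M'.code, N.code]
        (List.forall_mem_cons.2 ⟨h.der, List.forall_mem_cons.2 ⟨ih, by simp⟩⟩)
  · intro h
    obtain ⟨N', hN', h'⟩ := holds_of_der h M rfl
    rwa [code_injective hN']

/-! ### Representable functions are partial recursive -/

theorem primrec_code_num : Primrec fun m => (num m).code := by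
  -- `F` is the passage from `⌜m⌝` to `⌜m+1⌝` on codes, so the code of a numeral is obtained by
  -- primitive recursion.
  obtain ⟨F, hF, h⟩ : ∃ F : ℕ → ℕ, (∀ m, (num (m + 1)).code = F (num m).code) ∧ Primrec F := by
    refine ⟨fun a => nodeCode (Nat.pair 6 0) 1 (consCode (nodeCode (Nat.pair 6 0) 1
      (consCode (nodeCode (Nat.pair 4 0) 0 (consCode (varCode 1) (consCode (bangCode a)
        (Nat.pair 0 0)))) (Nat.pair 0 0))) (Nat.pair 0 0)), fun m => ?_, ?_⟩
    · rw [num]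
      simp only [code, listCode]
    have pair {f g : ℕ → ℕ} (hf : Primrec f) (hg : Primrec g) :
      Primrec fun a => Nat.pair (f a) (g a) := Primrec₂.natPair.comp hf hg
    have c (n : ℕ) : Primrec fun _ : ℕ => n := .const n
    have node (h b : ℕ) {f : ℕ → ℕ} (hf : Primrec f) : Primrec fun a => nodeCode h b (f a) :=
      pair (c _) (pair (c _) (pair (c _) hf))
    have cons {f g : ℕ → ℕ} (hf : Primrec f) (hg : Primrec g) :
      Primrec fun a => consCode (f a) (g a) := pair (c _) (pair hf hg)
    exact node _ _ (cons (node _ _ (cons (node _ _ (cons (c _)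
      (cons (pair (c _) .id) (c _)))) (c _))) (c _))
  refine (Primrec.nat_rec₁ (num 0).code (h.comp .snd).to₂).of_eq fun m => ?_
  induction m with
  | zero => rfl
  | succ m ih => exact (congrArg F ih).trans (hF m).symm

theorem primrec_code_appNums (M : Term) {n : ℕ} :
    Primrec fun v : List.Vector ℕ n => (M.appNums v).code := by
  have h : Primrec fun v : List.Vector ℕ n => v.toList.foldl
      (fun a m => nodeCode (Nat.pair 4 0) 0 (listCode [a, (num m).code])) M.code := by
    refine Primrec.list_foldl (h := fun _ x => nodeCode (Nat.pair 4 0) 0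
      (listCode [x.1, (num x.2).code])) Primrec.vector_toList (.const _) ?_
    have pair {f g : List.Vector ℕ n × ℕ × ℕ → ℕ} (hf : Primrec f) (hg : Primrec g) :
      Primrec fun a => Nat.pair (f a) (g a) := Primrec₂.natPair.comp hf hg
    have c (n : ℕ) {α : Type} [Primcodable α] : Primrec fun _ : α => n := .const n
    exact pair (c _) (pair (c _) (pair (c _) (pair (c _) (pair (Primrec.fst.comp .snd)
      (pair (c _) (pair (primrec_code_num.comp (Primrec.snd.comp .snd)) (c _)))))))
  refine h.of_eq fun v => ?_
  unfold appNums
  clear h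
  generalize v.toList = l
  induction l generalizing M with
  | nil => rfl
  | cons m l ih => exact ih (app M (num m))

theorem partrec_of_representable {U : ℕ → Σ n, Gate n} {n : ℕ} {f : List.Vector ℕ n →. ℕ}
    (hf : Representable U f) : Partrec f := by
  obtain ⟨M, -, hM⟩ := hf
  rw [represents_iff] at hM
  refine partrec_of_mem_iff_der clauses (g := fun v m => [6, (M.appNums v).code, (num m).code])
    ?_ fun v m => by rw [← (hM v).2 m, tSteps_iff_der]
  exact Primrec.list_cons.comp (.const 6) (Primrec.list_cons.comp
    ((primrec_code_appNums M).comp .fst) (Primrec.list_cons.comp (primrec_code_num.comp .snd)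
      (.const [])))

/-! ### The fragment without linear abstractions -/

/-- The terms built from variables by `!`, application and `λ!`, with free variables below `k`. -/
def Term.PureBelow : ℕ → Term → Prop
  | k, var i => i < k
  | k, bang M => M.PureBelow k
  | k, app M N => M.PureBelow k ∧ N.PureBelow k
  | k, lamBang M => M.PureBelow (k + 1)
  | _, _ => False

/-- The terms built from variables by `!`, application and `λ!`. -/
def Term.IsPure : Term → Prop
  | var _ => True
  | bang M => M.IsPure
  | app M N => M.IsPure ∧ N.IsPure
  | lamBang M => M.IsPure
  | _ => False

theorem Term.PureBelow.isPure {k : ℕ} {M : Term} (h : M.PureBelow k) : M.IsPure := by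
  induction M generalizing k with
  | var => trivial
  | bang M ih => exact ih (k := k) h
  | app M N ihM ihN => exact ⟨ihM h.1, ihN h.2⟩
  | lamBang M ih => exact ih (k := k + 1) h
  | qvar | bool | unitary | new | tuple | lam => exact h

theorem Term.PureBelow.subst_eq {k : ℕ} {M : Term} (h : M.PureBelow k) {σ : ℕ → Term}
    (hσ : ∀ i < k, σ i = var i) : M.subst σ = M := by
  induction M generalizing k σ with
  | var i => exact hσ i h
  | bang M ih => rw [subst, ih (k := k) h hσ]
  | app M N ihM ihN => rw [subst, ihM h.1 hσ, ihN h.2 hσ]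
  | lamBang M ih =>
    rw [subst, ih (k := k + 1) (σ := liftSub 1 σ) h fun i hi => ?_]
    cases i with
    | zero => rfl
    | succ i => simp [hσ i (by omega), shift, rename]
  | qvar | bool | unitary | new | tuple | lam => exact h.elim

theorem Term.PureBelow.rename_congr {k : ℕ} {M : Term} (h : M.PureBelow k) {ρ ρ' : ℕ → ℕ}
    (hρ : ∀ i < k, ρ i = ρ' i) : M.rename ρ = M.rename ρ' := by
  induction M generalizing k ρ ρ' with
  | var i => rw [rename, rename, hρ i h]
  | bang M ih => rw [rename, rename, ih (k := k) h hρ]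
  | app M N ihM ihN => rw [rename, rename, ihM h.1 hρ, ihN h.2 hρ]
  | lamBang M ih =>
    rw [rename, rename, ih (k := k + 1) (ρ := liftRen 1 ρ) (ρ' := liftRen 1 ρ') h fun i hi => ?_]
    cases i with
    | zero => rfl
    | succ i => simp [liftRen, hρ i (by omega)]
  | qvar | bool | unitary | new | tuple | lam => exact h.elim

theorem Term.IsPure.rename {M : Term} (h : M.IsPure) (ρ : ℕ → ℕ) : (M.rename ρ).IsPure := by
  induction M generalizing ρ with
  | var => trivial
  | bang M ih => exact ih h ρ
  | app M N ihM ihN => exact ⟨ihM h.1 ρ, ihN h.2 ρ⟩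
  | lamBang M ih => exact ih h _
  | qvar | bool | unitary | new | tuple | lam => exact h

theorem isPure_liftSub {σ : ℕ → Term} (hσ : ∀ i, (σ i).IsPure) (k i : ℕ) :
    (liftSub k σ i).IsPure := by
  unfold liftSub
  split_ifs
  · trivial
  · exact (hσ _).rename _

theorem Term.IsPure.subst {M : Term} (h : M.IsPure) {σ : ℕ → Term} (hσ : ∀ i, (σ i).IsPure) :
    (M.subst σ).IsPure := by
  induction M generalizing σ with
  | var i => exact hσ i
  | bang M ih => exact ih h hσ
  | app M N ihM ihN => exact ⟨ihM h.1 hσ, ihN h.2 hσ⟩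
  | lamBang M ih => exact ih (σ := liftSub 1 σ) h (isPure_liftSub hσ 1)
  | qvar | bool | unitary | new | tuple | lam => exact h

theorem isPure_single {N : Term} (h : N.IsPure) (i : ℕ) : (single N i).IsPure := by
  cases i
  · exact h
  · trivial

/-! ### Reduction by `cβ`: diamond property and strong normalization -/

/-- One step of reduction by `cβ` outside of the terms of the form `!M`. -/
inductive CStep : Term → Term → Prop
  | beta (M N : Term) : CStep (.app (.lamBang M) (.bang N)) (M.subst (single N))
  | app_right {M N N' : Term} : CStep N N' → CStep (.app M N) (.app M N')
  | app_left {M M' N : Term} : CStep M M' → CStep (.app M N) (.app M' N)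
  | in_lamBang {M M' : Term} : CStep M M' → CStep (.lamBang M) (.lamBang M')

/-- Reduction by `cβ` in finitely many steps. -/
abbrev CSteps : Term → Term → Prop := Relation.ReflTransGen CStep

theorem CStep.tStep {M M' : Term} (h : CStep M M') : TStep M M' := by
  induction h with
  | beta M N => exact .cβ M N
  | app_right _ ih => exact .app_right ih
  | app_left _ ih => exact .app_left ih
  | in_lamBang _ ih => exact .in_lamBang ih

/-- Every rule and context other than those of `CStep` involves a linear or pattern abstraction, a
tuple or `new`, none of which occurs in a pure term. -/
theorem TStep.cStep_of_isPure {M M' : Term} (h : TStep M M') (hM : M.IsPure) :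
    CStep M M' ∧ M'.IsPure := by
  induction h with
  | lβ => exact hM.1.elim
  | cβ M N => exact ⟨.beta M N, Term.IsPure.subst (M := M) hM.1 (isPure_single (N := N) hM.2)⟩
  | lcm => exact hM.2.1.elim
  | rcm => exact hM.1.1.elim
  | tuple => exact hM.elim
  | app_right _ ih => exact ⟨.app_right (ih hM.2).1, hM.1, (ih hM.2).2⟩
  | app_left _ ih => exact ⟨.app_left (ih hM.1).1, (ih hM.1).2, hM.2⟩
  | in_new => exact hM.elim
  | in_lamBang _ ih => exact ⟨.in_lamBang (ih hM).1, (ih hM).2⟩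
  | in_lam => exact hM.elim

theorem CStep.subst {M M' : Term} (h : CStep M M') (σ : ℕ → Term) :
    CStep (M.subst σ) (M'.subst σ) := by
  induction h generalizing σ with
  | beta M N =>
    rw [subst_single_subst]
    exact .beta _ _
  | app_right _ ih => exact .app_right (ih σ)
  | app_left _ ih => exact .app_left (ih σ)
  | in_lamBang _ ih => exact .in_lamBang (ih _)

/-- The argument of a redex is boxed, hence contains no active redex, and contraction neither copies
nor erases one. A step in the body of the abstraction survives the contraction by `CStep.subst`. So
a single step on each side closes the diagram. -/
theorem CStep.diamond {M A B : Term} (hA : CStep M A) (hB : CStep M B) :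
    A = B ∨ ∃ C, CStep A C ∧ CStep B C := by
  induction hA generalizing B with
  | beta M N =>
    cases hB with
    | beta => exact .inl rfl
    | app_right h => cases h
    | app_left h =>
      cases h with
      | in_lamBang h => exact .inr ⟨_, h.subst _, .beta _ _⟩
  | app_right h ih =>
    cases hB with
    | beta => cases h
    | app_right h' =>
      rcases ih h' with rfl | ⟨C, hC, hC'⟩
      · exact .inl rfl
      · exact .inr ⟨_, .app_right hC, .app_right hC'⟩
    | app_left h' => exact .inr ⟨_, .app_left h', .app_right h⟩
  | app_left h ih =>
    cases hB with
    | beta =>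
      cases h with
      | in_lamBang h => exact .inr ⟨_, .beta _ _, h.subst _⟩
    | app_right h' => exact .inr ⟨_, .app_right h', .app_left h⟩
    | app_left h' =>
      rcases ih h' with rfl | ⟨C, hC, hC'⟩
      · exact .inl rfl
      · exact .inr ⟨_, .app_left hC, .app_left hC'⟩
  | in_lamBang h ih =>
    cases hB with
    | in_lamBang h' =>
      rcases ih h' with rfl | ⟨C, hC, hC'⟩
      · exact .inl rfl
      · exact .inr ⟨_, .in_lamBang hC, .in_lamBang hC'⟩

/-- Strong normalization for `CStep`. -/
def SN (M : Term) : Prop := Acc (fun N M => CStep M N) M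

/-- Any other reduct of `M` shares a one-step reduct with `M'`, to which the induction hypothesis
applies. With many-step joins this argument would fail, which is why the strict form of the diamond
matters. -/
theorem SN.of_cStep {M M' : Term} (h : SN M') (hM : CStep M M') : SN M := by
  induction h generalizing M with
  | intro M' h' ih =>
    refine ⟨_, fun N hN => ?_⟩
    rcases hM.diamond hN with rfl | ⟨C, hC, hC'⟩
    · exact ⟨_, h'⟩
    · exact ih C hC hC'

theorem SN.cSteps {M N : Term} (h : SN M) (hM : CSteps M N) : SN N := by
  induction hM with
  | refl => exact h
  | tail _ h' ih => exact ih.inv h'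

theorem SN.of_normal {M N : Term} (h : CSteps M N) (hN : ∀ N', ¬ CStep N N') : SN M := by
  induction h using Relation.ReflTransGen.head_induction_on with
  | refl => exact ⟨_, fun N' h => (hN N' h).elim⟩
  | head h _ ih => exact ih.of_cStep h

/-- Termination passes to the two sides of an application. This is how termination of a compiled
program yields termination of its subprograms. -/
theorem SN.app_left {M N : Term} (h : SN (.app M N)) : SN M := by
  generalize hP : Term.app M N = P at h
  induction h generalizing M with
  | intro P _ ih =>
    subst hP
    exact ⟨_, fun M' hM' => ih _ (.app_left hM') rfl⟩

theorem SN.app_right {M N : Term} (h : SN (.app M N)) : SN N := by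
  generalize hP : Term.app M N = P at h
  induction h generalizing N with
  | intro P _ ih =>
    subst hP
    exact ⟨_, fun N' hN' => ih _ (.app_right hN') rfl⟩

theorem CSteps.eq_of_normal {M A B : Term} (hA : CSteps M A) (hB : CSteps M B)
    (hA' : ∀ N, ¬ CStep A N) (hB' : ∀ N, ¬ CStep B N) : A = B := by
  obtain ⟨C, hAC, hBC⟩ := Relation.church_rosser (fun a b c hab hac => by
    rcases hab.diamond hac with rfl | ⟨d, hd, hd'⟩
    · exact ⟨b, .refl, .refl⟩
    · exact ⟨d, .single hd, .single hd'⟩) hA hB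
  rcases hAC.cases_head with rfl | ⟨N, hN, -⟩
  · rcases hBC.cases_head with rfl | ⟨N, hN, -⟩
    · rfl
    · exact (hB' N hN).elim
  · exact (hA' N hN).elim

theorem CSteps.app_left {M M' : Term} (h : CSteps M M') (N : Term) :
    CSteps (.app M N) (.app M' N) := by
  induction h with
  | refl => exact .refl
  | tail _ h ih => exact ih.tail (.app_left h)

theorem CSteps.app_right (M : Term) {N N' : Term} (h : CSteps N N') :
    CSteps (.app M N) (.app M N') := by
  induction h with
  | refl => exact .refl
  | tail _ h ih => exact ih.tail (.app_right h)

theorem CSteps.tSteps {M N : Term} (h : CSteps M N) : TSteps M N := by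
  induction h with
  | refl => exact .refl
  | tail _ h ih => exact ih.tail h.tStep

theorem CStep.beta_of_eq {M N P : Term} (h : M.subst (single N) = P) :
    CStep (.app (.lamBang M) (.bang N)) P :=
  h ▸ .beta M N

theorem CSteps.beta {M N P : Term} (h : M.subst (single N) = P) :
    CSteps (.app (.lamBang M) (.bang N)) P :=
  h ▸ .single (.beta M N)

/-! ### Numerals and lists of natural numbers -/

theorem pureBelow_num (k n : ℕ) : (num n).PureBelow k := by
  induction n generalizing k with
  | zero => exact Nat.succ_pos _
  | succ n ih => exact ⟨by simp [PureBelow], ih _⟩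

theorem not_cStep_num (n : ℕ) (N : Term) : ¬ CStep (num n) N := by
  intro h
  cases n with
  | zero =>
    rcases h with _ | _ | _ | h
    rcases h with _ | _ | _ | h
    cases h
  | succ n =>
    rcases h with _ | _ | _ | h
    rcases h with _ | _ | _ | h
    rcases h with _ | h | h
    · cases h
    · cases h

theorem num_injective : Function.Injective num := by
  intro m
  induction m with
  | zero => rintro (_ | n) <;> simp [num]
  | succ m ih =>
    rintro (_ | n)
    · simp [num]
    · simp only [num, lamBang.injEq, app.injEq, bang.injEq, true_and]
      exact fun h => congrArg _ (ih h)

/-- The list with head `h` and tail `t`, which live under two more binders. -/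
def consTerm (h t : Term) : Term :=
  lamBang (lamBang (app (app (var 1) (bang h)) (bang t)))

/-- The encoding of lists of natural numbers. -/
def listTerm : List ℕ → Term
  | [] => lamBang (lamBang (var 0))
  | a :: l => consTerm (num a) (listTerm l)

theorem pureBelow_listTerm (k : ℕ) (l : List ℕ) : (listTerm l).PureBelow k := by
  induction l generalizing k with
  | nil => exact Nat.succ_pos _
  | cons a l ih => exact ⟨⟨by simp [PureBelow], pureBelow_num _ a⟩, ih _⟩

/-- The successor of `h`, which lives under two more binders. -/
def succTerm (h : Term) : Term := lamBang (lamBang (app (var 1) (bang h)))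

/-! ### Compilation of partial recursive functions into the pure fragment -/

open Turing.ToPartrec (Code)

/-- The iteration of `F`, as a function of itself and of its argument. -/
def fixTerm (F : Term) : Term :=
  lamBang (lamBang (app (lamBang (app (app (var 0) (bang (lamBang (lamBang (app (app (var 1)
    (bang (lamBang (app (app (var 5) (bang (var 5))) (bang (var 1))))))
    (bang (bang (var 0)))))))) (bang (bang (listTerm [])))))
    (app F (bang (var 0)))))

/-- The compilation of partial recursive functions on lists to terms, which map the encoding
`!l` of a list to the encoding `!l'` of the value. -/
def codeTerm : Code → Term
  | .zero' => lamBang (bang (consTerm (num 0) (var 2)))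
  | .succ => lamBang (app (app (var 0) (bang (lamBang (lamBang (bang
      (consTerm (succTerm (var 5)) (listTerm [])))))))
      (bang (bang (listTerm [1]))))
  | .tail => lamBang (app (app (var 0) (bang (lamBang (lamBang (bang (var 0))))))
      (bang (bang (listTerm []))))
  | .cons f fs => lamBang (app (app
      (lamBang (lamBang (app (app (var 1) (bang (lamBang (lamBang (bang
        (consTerm (var 3) (var 4))))))) (bang (bang (consTerm (num 0) (var 2)))))))
      (app (codeTerm f) (bang (var 0)))) (app (codeTerm fs) (bang (var 0))))
  | .comp f g => lamBang (app (codeTerm f) (app (codeTerm g) (bang (var 0))))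
  | .case f g => lamBang (app (app (var 0) (bang (lamBang (lamBang (app (app (var 1)
      (bang (lamBang (app (codeTerm g) (bang (consTerm (var 2) (var 3)))))))
      (bang (app (codeTerm f) (bang (var 0)))))))))
      (bang (app (codeTerm f) (bang (listTerm [])))))
  | .fix f => app (fixTerm (codeTerm f)) (bang (fixTerm (codeTerm f)))

theorem pureBelow_codeTerm (k : ℕ) (c : Code) : (codeTerm c).PureBelow k := by
  induction c generalizing k <;>
    simp [codeTerm, PureBelow, consTerm, succTerm, fixTerm, pureBelow_num, pureBelow_listTerm, *]

@[simp] theorem shift_var (i k : ℕ) : (var i).shift k = var (i + k) := rfl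

@[simp] theorem subst_num (n : ℕ) (σ : ℕ → Term) : (num n).subst σ = num n :=
  (pureBelow_num 0 n).subst_eq (by simp)

@[simp] theorem subst_listTerm (l : List ℕ) (σ : ℕ → Term) : (listTerm l).subst σ = listTerm l :=
  (pureBelow_listTerm 0 l).subst_eq (by simp)

@[simp] theorem subst_codeTerm (c : Code) (σ : ℕ → Term) : (codeTerm c).subst σ = codeTerm c :=
  (pureBelow_codeTerm 0 c).subst_eq (by simp)

@[simp] theorem shift_num (n k : ℕ) : (num n).shift k = num n := by
  rw [shift, rename_eq_subst, subst_num]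

@[simp] theorem shift_listTerm (l : List ℕ) (k : ℕ) : (listTerm l).shift k = listTerm l := by
  rw [shift, rename_eq_subst, subst_listTerm]

@[simp] theorem subst_fixTerm_codeTerm (c : Code) (σ : ℕ → Term) :
    (fixTerm (codeTerm c)).subst σ = fixTerm (codeTerm c) := by
  have := pureBelow_codeTerm 0 (.fix c)
  exact PureBelow.subst_eq (k := 0) this.1 (by simp)

@[simp] theorem shift_fixTerm_codeTerm (c : Code) (k : ℕ) :
    (fixTerm (codeTerm c)).shift k = fixTerm (codeTerm c) := by
  rw [shift, rename_eq_subst, subst_fixTerm_codeTerm]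

theorem subst_consTerm (h t : Term) (σ : ℕ → Term) :
    (consTerm h t).subst σ =
      consTerm (h.subst (liftSub 1 (liftSub 1 σ))) (t.subst (liftSub 1 (liftSub 1 σ))) := rfl

theorem subst_succTerm (h : Term) (σ : ℕ → Term) :
    (succTerm h).subst σ = succTerm (h.subst (liftSub 1 (liftSub 1 σ))) := rfl

/-! ### Simulation of the programs by reduction -/

theorem cSteps_num_zero {P Z : Term} : CSteps (app (app (num 0) (bang P)) (bang Z)) Z :=
  ((CSteps.beta (P := lamBang (var 0)) rfl).app_left _).trans (CSteps.beta rfl)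

theorem cSteps_num_succ (n : ℕ) {P Z : Term} :
    CSteps (app (app (num (n + 1)) (bang P)) (bang Z)) (app P (bang (num n))) := by
  refine ((CSteps.beta (P := lamBang (app (P.shift 1) (bang (num n)))) ?_).app_left _).trans
    (CSteps.beta ?_) <;> simp [subst]

theorem cSteps_listTerm_nil {P Z : Term} :
    CSteps (app (app (listTerm []) (bang P)) (bang Z)) Z :=
  ((CSteps.beta (P := lamBang (var 0)) rfl).app_left _).trans (CSteps.beta rfl)

theorem cSteps_listTerm_cons (a : ℕ) (l : List ℕ) {P Z : Term} :
    CSteps (app (app (listTerm (a :: l)) (bang P)) (bang Z))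
      (app (app P (bang (num a))) (bang (listTerm l))) := by
  refine ((CSteps.beta (P := lamBang (app (app (P.shift 1) (bang (num a))) (bang (listTerm l))))
    ?_).app_left _).trans (CSteps.beta ?_) <;> simp [subst]

theorem cSteps_beta₂ {M N N' P : Term}
    (h : (M.subst (liftSub 1 (single N))).subst (single N') = P) :
    CSteps (app (app (lamBang (lamBang M)) (bang N)) (bang N')) P :=
  ((CSteps.beta rfl).app_left _).trans (CSteps.beta h)

theorem cSteps_zero' (v : List ℕ) :
    CSteps (app (codeTerm .zero') (bang (listTerm v))) (bang (listTerm (0 :: v))) := by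
  apply CSteps.beta
  simp [subst, subst_consTerm, listTerm]

theorem cSteps_succ (v : List ℕ) :
    CSteps (app (codeTerm .succ) (bang (listTerm v))) (bang (listTerm [v.headI.succ])) := by
  refine (CSteps.beta rfl).trans ?_
  cases v with
  -- The head of the empty list counts as `0`, so the default branch holds the list `[1]`.
  | nil => exact cSteps_listTerm_nil
  | cons a l =>
    refine (cSteps_listTerm_cons a l).trans (cSteps_beta₂ ?_)
    simp [subst, subst_consTerm, subst_succTerm, listTerm]
    rfl

theorem cSteps_tail (v : List ℕ) :
    CSteps (app (codeTerm .tail) (bang (listTerm v))) (bang (listTerm v.tail)) := by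
  refine (CSteps.beta rfl).trans ?_
  cases v with
  | nil => exact cSteps_listTerm_nil
  | cons a l =>
    refine (cSteps_listTerm_cons a l).trans (cSteps_beta₂ ?_)
    simp [subst]

theorem cSteps_consTerm (a : ℕ) (l : List ℕ) :
    CSteps (app (app (lamBang (lamBang (bang (consTerm (var 3) (var 2))))) (bang (num a)))
      (bang (listTerm l))) (bang (listTerm (a :: l))) := by
  refine cSteps_beta₂ ?_
  simp [subst, subst_consTerm, listTerm]

theorem cSteps_cons_head (w v : List ℕ) :
    CSteps (app (app (lamBang (lamBang (app (app (var 1) (bang (lamBang (lamBang (bang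
      (consTerm (var 3) (var 4))))))) (bang (bang (consTerm (num 0) (var 2)))))))
      (bang (listTerm w))) (bang (listTerm v))) (bang (listTerm (w.headI :: v))) := by
  refine (cSteps_beta₂ rfl).trans ?_
  cases w with
  | nil =>
    simp only [subst, subst_consTerm, liftSub_one_succ, liftSub_one_zero, single_zero]
    simp only [shift_listTerm, subst_listTerm]
    refine cSteps_listTerm_nil.trans ?_
    simp [subst, listTerm]
    exact .refl
  | cons a l =>
    simp only [subst, subst_consTerm, liftSub_one_succ, liftSub_one_zero, single_zero]
    simp only [shift_listTerm, subst_listTerm]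
    refine (cSteps_listTerm_cons a l).trans (cSteps_beta₂ ?_)
    simp [subst, subst_consTerm, listTerm]

theorem cSteps_cons (f fs : Code) (v : List ℕ) :
    CSteps (app (codeTerm (.cons f fs)) (bang (listTerm v)))
      (app (app (lamBang (lamBang (app (app (var 1) (bang (lamBang (lamBang (bang
        (consTerm (var 3) (var 4))))))) (bang (bang (consTerm (num 0) (var 2)))))))
        (app (codeTerm f) (bang (listTerm v)))) (app (codeTerm fs) (bang (listTerm v)))) := by
  apply CSteps.beta
  simp [subst, subst_consTerm]

theorem cSteps_comp (f g : Code) (v : List ℕ) :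
    CSteps (app (codeTerm (.comp f g)) (bang (listTerm v)))
      (app (codeTerm f) (app (codeTerm g) (bang (listTerm v)))) := by
  apply CSteps.beta
  simp [subst]

/-- Both branches are boxed, so neither is evaluated before the head of the list selects one. The
empty list behaves as one with head `0` and empty tail. -/
theorem cSteps_case (f g : Code) (v : List ℕ) :
    CSteps (app (codeTerm (.case f g)) (bang (listTerm v)))
      (v.headI.rec (app (codeTerm f) (bang (listTerm v.tail)))
        fun y _ => app (codeTerm g) (bang (listTerm (y :: v.tail)))) := by
  refine (CSteps.beta rfl).trans ?_
  rcases v with _ | ⟨a, l⟩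
  · refine cSteps_listTerm_nil.trans ?_
    simp [subst]
    exact .refl
  · refine (cSteps_listTerm_cons a l).trans ((cSteps_beta₂ rfl).trans ?_)
    simp [subst, subst_consTerm]
    cases a with
    | zero => exact cSteps_num_zero
    | succ n =>
      refine (cSteps_num_succ n).trans (CSteps.beta ?_)
      simp [subst, subst_consTerm, listTerm]

/-- The body of a loop, as a function of the value of the iterated function. -/
def loopTerm (F : Term) : Term :=
  lamBang (app (app (var 0) (bang (lamBang (lamBang (app (app (var 1)
    (bang (lamBang (app (app F (bang F)) (bang (var 1))))))
    (bang (bang (var 0)))))))) (bang (bang (listTerm []))))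

/-- The fixed point is a self-application. `TransGen` records that a turn of the loop costs at least
one step, which makes the termination argument in `dom_eval_of_sn` well-founded. -/
theorem cSteps_fix (f : Code) (v : List ℕ) :
    Relation.TransGen CStep (app (codeTerm (.fix f)) (bang (listTerm v)))
      (app (loopTerm (fixTerm (codeTerm f))) (app (codeTerm f) (bang (listTerm v)))) := by
  refine .tail' ((CSteps.beta (P := lamBang (app (loopTerm (fixTerm (codeTerm f)))
    (app (codeTerm f) (bang (var 0))))) ?_).app_left _) (CStep.beta_of_eq ?_)
  · simp [subst, loopTerm]
  · simp [subst, loopTerm]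

/-- The recursive call sits in a box that is opened only for a nonzero head, so the loop does not
unfold by itself. -/
theorem cSteps_loop (f : Code) (w : List ℕ) :
    CSteps (app (loopTerm (fixTerm (codeTerm f))) (bang (listTerm w)))
      (if w.headI = 0 then bang (listTerm w.tail)
        else app (codeTerm (.fix f)) (bang (listTerm w.tail))) := by
  refine (CSteps.beta rfl).trans ?_
  rcases w with _ | ⟨a, l⟩
  · exact cSteps_listTerm_nil
  · refine (cSteps_listTerm_cons a l).trans ((cSteps_beta₂ rfl).trans ?_)
    simp [subst]
    cases a with
    | zero => exact cSteps_num_zero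
    | succ n =>
      refine (cSteps_num_succ n).trans (CSteps.beta ?_)
      simp [subst, codeTerm]

/-- Call by value: a `λ!` fires only once its argument has become a box, that is, once the inner
program has delivered its list. -/
theorem cSteps_codeTerm {c : Code} {v w : List ℕ} (h : w ∈ c.eval v) :
    CSteps (app (codeTerm c) (bang (listTerm v))) (bang (listTerm w)) := by
  induction c generalizing v w with
  | zero' =>
    simp only [Code.zero'_eval, Part.pure_eq_some, Part.mem_some_iff] at h
    exact h ▸ cSteps_zero' v
  | succ =>
    simp only [Code.succ_eval, Part.pure_eq_some, Part.mem_some_iff] at h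
    exact h ▸ cSteps_succ v
  | tail =>
    simp only [Code.tail_eval, Part.pure_eq_some, Part.mem_some_iff] at h
    exact h ▸ cSteps_tail v
  | cons f fs ihf ihfs =>
    simp only [Code.cons_eval, Part.bind_eq_bind, Part.mem_bind_iff, Part.pure_eq_some,
      Part.mem_some_iff] at h
    obtain ⟨a, ha, b, hb, rfl⟩ := h
    exact (cSteps_cons f fs v).trans ((((ihf ha).app_right _).app_left _).trans
      (((ihfs hb).app_right _).trans (cSteps_cons_head a b)))
  | comp f g ihf ihg =>
    rw [Code.comp_eval] at h
    obtain ⟨a, ha, hw⟩ := Part.mem_bind_iff.1 h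
    exact (cSteps_comp f g v).trans (((ihg ha).app_right _).trans (ihf hw))
  | case f g ihf ihg =>
    simp only [Code.case_eval] at h
    refine (cSteps_case f g v).trans ?_
    generalize v.headI = a at h
    cases a with
    | zero => exact ihf h
    | succ n => exact ihg h
  | fix f ih =>
    rw [Code.fix_eval] at h
    refine PFun.fixInduction' (C := fun v => CSteps (app (codeTerm (.fix f)) (bang (listTerm v)))
      (bang (listTerm w))) h (fun v hv => ?_) fun v v' _ hv ih' => ?_
    · obtain ⟨a, ha, hav⟩ := (Part.mem_map_iff _).1 hv
      refine (cSteps_fix f v).to_reflTransGen.trans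
        (((ih ha).app_right _).trans ((cSteps_loop f a).trans ?_))
      split_ifs at hav ⊢ with h0
      rw [Sum.inl.inj hav]
    · obtain ⟨a, ha, hav⟩ := (Part.mem_map_iff _).1 hv
      refine (cSteps_fix f v).to_reflTransGen.trans
        (((ih ha).app_right _).trans ((cSteps_loop f a).trans ?_))
      split_ifs at hav ⊢ with h0
      rw [Sum.inr.inj hav]
      exact ih'

/-- Subprograms that are run occur as reducts or as subterms outside boxes, so they inherit strong
normalization. Their values, known to be defined by induction, are then fed to the next stage by
`cSteps_codeTerm`. -/
theorem dom_eval_of_sn {c : Code} {v : List ℕ}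
    (h : SN (app (codeTerm c) (bang (listTerm v)))) : (c.eval v).Dom := by
  induction c generalizing v with
  | zero' | succ | tail => simp [Code.eval]
  | cons f fs ihf ihfs =>
    have h' := h.cSteps (cSteps_cons f fs v)
    have hf := ihf h'.app_left.app_right
    have hfs := ihfs h'.app_right
    rw [Part.dom_iff_mem] at hf hfs ⊢
    obtain ⟨a, ha⟩ := hf
    obtain ⟨b, hb⟩ := hfs
    refine ⟨a.headI :: b, ?_⟩
    simp only [Code.cons_eval, Part.bind_eq_bind, Part.mem_bind_iff, Part.pure_eq_some,
      Part.mem_some_iff]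
    exact ⟨a, ha, b, hb, rfl⟩
  | comp f g ihf ihg =>
    have h' := h.cSteps (cSteps_comp f g v)
    obtain ⟨a, ha⟩ := Part.dom_iff_mem.1 (ihg h'.app_right)
    obtain ⟨b, hb⟩ := Part.dom_iff_mem.1
      (ihf (h'.cSteps ((cSteps_codeTerm ha).app_right _)))
    rw [Code.comp_eval]
    exact Part.dom_iff_mem.2 ⟨b, Part.mem_bind_iff.2 ⟨a, ha, hb⟩⟩
  | case f g ihf ihg =>
    have h' := h.cSteps (cSteps_case f g v)
    simp only [Code.case_eval]
    generalize v.headI = a at h'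
    cases a with
    | zero => exact ihf h'
    | succ n => exact ihg h'
  | fix f ih =>
    -- An inner induction on reductions of positive length bounds the number of turns of the loop.
    have h' := Acc.transGen h
    generalize hM : app (codeTerm (.fix f)) (bang (listTerm v)) = M at h'
    induction h' generalizing v with
    | intro M _ ih' =>
      subst hM
      have h₁ := h.cSteps (cSteps_fix f v).to_reflTransGen
      obtain ⟨a, ha⟩ := Part.dom_iff_mem.1 (ih h₁.app_right)
      -- A complete turn: from the loop at `v` to its exit value, or to the loop at `a.tail`, in at
      -- least one step.
      have h₂ := (cSteps_fix f v).trans_left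
        (((cSteps_codeTerm ha).app_right _).trans (cSteps_loop f a))
      rw [Code.fix_eval] at ih' ⊢
      by_cases h0 : a.headI = 0
      · exact Part.dom_iff_mem.2 ⟨a.tail, PFun.mem_fix_iff.2
          (.inl ((Part.mem_map_iff _).2 ⟨a, ha, by simp [h0]⟩))⟩
      · rw [if_neg h0] at h₂
        obtain ⟨b, hb⟩ := Part.dom_iff_mem.1 (ih' _ (Relation.transGen_swap.2 h₂)
          (h.cSteps h₂.to_reflTransGen) rfl)
        exact Part.dom_iff_mem.2 ⟨b, PFun.mem_fix_iff.2
          (.inr ⟨a.tail, (Part.mem_map_iff _).2 ⟨a, ha, by simp [h0]⟩, hb⟩)⟩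

/-! ### From unboxed numerals to the result of a program -/

/-- The list `!l`, built from terms which reduce to numerals. -/
def buildTerm : List Term → Term
  | [] => bang (listTerm [])
  | M :: Ms => app (app (lamBang (lamBang (bang (consTerm (var 3) (var 2)))))
      (app (app M (bang (lamBang (bang (succTerm (var 2)))))) (bang (bang (num 0)))))
      (buildTerm Ms)

theorem subst_buildTerm (Ms : List Term) (σ : ℕ → Term) :
    (buildTerm Ms).subst σ = buildTerm (Ms.map fun M => M.subst σ) := by
  induction Ms with
  | nil => simp [buildTerm, subst]
  | cons M Ms ih => simp [buildTerm, subst, subst_consTerm, subst_succTerm, ih]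

/-- A numeral is its own case distinction: with the branches `!0` and `λ!y.!(y+1)` it rebuilds
itself inside a box, whether it is zero or a successor. No recursion is needed, since a numeral
stores its predecessor already boxed. -/
theorem cSteps_buildTerm (l : List ℕ) : CSteps (buildTerm (l.map num)) (bang (listTerm l)) := by
  induction l with
  | nil => exact .refl
  | cons a l ih =>
    have h : CSteps (app (app (num a) (bang (lamBang (bang (succTerm (var 2))))))
        (bang (bang (num 0)))) (bang (num a)) := by
      cases a with
      | zero => exact cSteps_num_zero
      | succ n =>
        refine (cSteps_num_succ n).trans (CSteps.beta ?_)
        simp [subst, num, succTerm]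
    exact ((h.app_right _).app_left _).trans ((ih.app_right _).trans (cSteps_consTerm a l))

/-- The term that extracts the first element of a list `!l`. -/
def headTerm : Term :=
  lamBang (app (app (var 0) (bang (lamBang (lamBang (var 1))))) (bang (num 0)))

theorem cSteps_headTerm (l : List ℕ) :
    CSteps (app headTerm (bang (listTerm l))) (num l.headI) := by
  refine (CSteps.beta rfl).trans ?_
  cases l with
  | nil => exact cSteps_listTerm_nil
  | cons a l =>
    refine (cSteps_listTerm_cons a l).trans (cSteps_beta₂ ?_)
    simp [subst]

/-- The term that computes, for the terms `Ms` with numerals as values, the first element of the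
list computed by `c`. -/
def computeTerm (c : Code) (Ms : List Term) : Term := app headTerm (app (codeTerm c) (buildTerm Ms))

theorem cSteps_computeTerm {c : Code} {v w : List ℕ} (h : w ∈ c.eval v) :
    CSteps (computeTerm c (v.map num)) (num w.headI) :=
  (((cSteps_buildTerm v).app_right _).app_right _).trans
    (((cSteps_codeTerm h).app_right _).trans (cSteps_headTerm w))

theorem dom_eval_of_sn_computeTerm {c : Code} {v : List ℕ} (h : SN (computeTerm c (v.map num))) :
    (c.eval v).Dom :=
  dom_eval_of_sn (h.app_right.cSteps ((cSteps_buildTerm v).app_right _))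

theorem isPure_buildTerm {Ms : List Term} (h : ∀ M ∈ Ms, M.IsPure) : (buildTerm Ms).IsPure := by
  induction Ms with
  | nil => exact (pureBelow_listTerm 0 []).isPure
  | cons M Ms ih =>
    simp only [List.mem_cons, forall_eq_or_imp] at h
    simp [buildTerm, IsPure, consTerm, succTerm, h.1, ih h.2, (pureBelow_num 0 0).isPure]

theorem isPure_computeTerm (c : Code) {Ms : List Term} (h : ∀ M ∈ Ms, M.IsPure) :
    (computeTerm c Ms).IsPure :=
  ⟨by simp [headTerm, IsPure, (pureBelow_num 0 0).isPure],
    (pureBelow_codeTerm 0 c).isPure, isPure_buildTerm h⟩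

theorem subst_computeTerm (c : Code) (Ms : List Term) (σ : ℕ → Term) :
    (computeTerm c Ms).subst σ = computeTerm c (Ms.map fun M => M.subst σ) := by
  simp [computeTerm, subst, subst_buildTerm, headTerm]

/-! ### Linear abstractions applied to numerals -/

/-- The substitution `σ`, with the variable with index `0` mapped to `N`. -/
def consSub (N : Term) (σ : ℕ → Term) : ℕ → Term
  | 0 => N
  | i + 1 => σ i

/-- `Unfold M s σ P` means that `P` is obtained by contracting the linear redexes of `M`, which is
applied to the numerals in `s`, and by replacing its free variables according to `σ`. -/
inductive Unfold : Term → List ℕ → (ℕ → Term) → Term → Prop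
  | base {M : Term} {σ : ℕ → Term} : M.IsPure → Unfold M [] σ (M.subst σ)
  | lam {M P : Term} {m : ℕ} {s : List ℕ} {σ : ℕ → Term} :
      Unfold M s (consSub (num m) σ) P → Unfold (.lam 0 M) (m :: s) σ P
  | app {M N P : Term} {s : List ℕ} {σ : ℕ → Term} (m : ℕ) :
      N = num m → Unfold M (m :: s) σ P → Unfold (.app M N) s σ P

/-- Part of the pending substitution may be carried out on the term without changing the result `P`.
With `τ` the substitution of a numeral this is invariance under `lβ`. -/
theorem Unfold.subst {M P : Term} {s : List ℕ} {σ' : ℕ → Term} (h : Unfold M s σ' P)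
    {σ τ : ℕ → Term} (hσ : ∀ i, σ' i = (τ i).subst σ) (hτ : ∀ i, (τ i).IsPure) :
    Unfold (M.subst τ) s σ P := by
  induction h generalizing σ τ with
  | @base M σ' hM =>
    obtain rfl : σ' = _ := funext hσ
    rw [← subst_subst]
    exact .base (hM.subst hτ)
  | lam _ ih =>
    refine .lam (ih (fun i => ?_) (isPure_liftSub hτ 1))
    cases i with
    | zero => rfl
    | succ i =>
      rw [liftSub_one_succ, shift, subst_rename]
      exact hσ i
  | app m hN _ ih => exact .app m (by rw [hN, subst_num]) (ih hσ hτ)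

theorem not_tStep_num (n : ℕ) (N : Term) : ¬ TStep (num n) N :=
  fun h => not_cStep_num n N (h.cStep_of_isPure (pureBelow_num 0 n).isPure).1

/-- A simulation: `lβ` and `rcm` only rearrange the linear redexes and leave `P` unchanged, whereas
a step in the pure body is mirrored by a `cβ`-step of `P`. -/
theorem Unfold.tStep {M M' P : Term} {s : List ℕ} {σ : ℕ → Term} (h : Unfold M s σ P)
    (hM : TStep M M') : ∃ P', Unfold M' s σ P' ∧ CSteps P P' := by
  induction h generalizing M' with
  | base hp =>
    obtain ⟨h, hp'⟩ := hM.cStep_of_isPure hp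
    exact ⟨_, .base hp', .single (h.subst _)⟩
  | lam _ ih =>
    cases hM with
    | in_lam _ hM =>
      obtain ⟨P', h, h'⟩ := ih hM
      exact ⟨P', .lam h, h'⟩
  | @app M N P s σ m hN h ih =>
    cases hM with
    | lβ M _ =>
      cases h with
      | lam h =>
        subst hN
        refine ⟨P, h.subst (fun i => ?_) (isPure_single (pureBelow_num 0 m).isPure), .refl⟩
        cases i with
        | zero => exact (subst_num m σ).symm
        | succ i => rfl
    -- The argument is a numeral, hence neither a box nor an application; this excludes `cβ` and
    -- `lcm` at the root.
    | cβ => cases m <;> cases hN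
    | lcm => cases m <;> cases hN
    -- The outer numeral moves under the abstraction. Being closed it is unaffected by the shift,
    -- and it meets the same abstraction as before.
    | rcm k _ M N' =>
      cases h with
      | app m' hN' h =>
        cases h with
        | lam h =>
          subst hN hN'
          exact ⟨P, .app m' rfl (.lam (.app m (shift_num m _) h)), .refl⟩
    | app_right hM => exact (not_tStep_num m _ (hN ▸ hM)).elim
    | app_left hM =>
      obtain ⟨P', h, h'⟩ := ih hM
      exact ⟨P', .app m hN h, h'⟩

theorem Unfold.tSteps {M M' P : Term} {s : List ℕ} {σ : ℕ → Term} (h : Unfold M s σ P)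
    (hM : TSteps M M') : ∃ P', Unfold M' s σ P' ∧ CSteps P P' := by
  induction hM with
  | refl => exact ⟨P, h, .refl⟩
  | tail _ hM ih =>
    obtain ⟨P', h₁, h₂⟩ := ih
    obtain ⟨P'', h₃, h₄⟩ := h₁.tStep hM
    exact ⟨P'', h₃, h₂.trans h₄⟩

theorem Unfold.exists_tStep {M N P : Term} {m : ℕ} {s : List ℕ} {σ : ℕ → Term}
    (h : Unfold M (m :: s) σ P) : ∃ M', TStep (.app M N) M' := by
  generalize hs : m :: s = s' at h
  induction h generalizing m s N with
  | base => cases hs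
  | lam => exact ⟨_, .lβ _ _⟩
  | app _ _ _ ih =>
    obtain ⟨M', hM'⟩ := ih rfl
    exact ⟨_, .app_left hM'⟩

/-- A remaining application to a numeral would expose a linear redex by `Unfold.exists_tStep`, so a
normal term has nothing left to unfold. -/
theorem Unfold.eq_of_normal {M P : Term} (h : Unfold M [] var P) (hM : ∀ M', ¬ TStep M M') :
    P = M := by
  cases h with
  | base => exact subst_var M
  | app m _ h =>
    obtain ⟨M', hM'⟩ := h.exists_tStep
    exact (hM M' hM').elim

theorem TSteps.foldl_app {M M' : Term} (h : TSteps M M') (s : List ℕ) :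
    TSteps (s.foldl (fun t m => app t (num m)) M) (s.foldl (fun t m => app t (num m)) M') := by
  induction s generalizing M M' with
  | nil => exact h
  | cons m s ih =>
    refine ih ?_
    induction h with
    | refl => exact .refl
    | tail _ h ih => exact ih.tail (.app_left h)

theorem Unfold.tSteps_foldl {M P : Term} {s : List ℕ} {σ : ℕ → Term} (h : Unfold M s σ P) :
    TSteps (s.foldl (fun N m => .app N (num m)) (M.subst σ)) P := by
  induction h with
  | base => exact .refl
  | @lam M P m s σ _ ih =>
    refine .trans (TSteps.foldl_app (.single (.lβ _ _)) s) ?_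
    rw [subst_subst]
    convert ih with i
    cases i <;> simp [consSub, Term.subst]
  | app m hN _ ih =>
    rw [hN, Term.subst, subst_num]
    exact ih

theorem Unfold.foldl_app {M P : Term} {s t : List ℕ} {σ : ℕ → Term} (h : Unfold M (s ++ t) σ P) :
    Unfold (s.foldl (fun N m => .app N (num m)) M) t σ P := by
  induction s generalizing M with
  | nil => exact h
  | cons m s ih => exact ih (.app m rfl h)

/-- The abstraction of `M` over the free variables `xs`. -/
def lams : List ℕ → Term → Term
  | [], M => M
  | x :: xs, M => lam 0 ((lams xs M).abstr (k := 0) fun _ => x)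

/-- The substitution `σ`, with the variables `xs` mapped to the numerals for `s`. -/
def updateNums (σ : ℕ → Term) : List ℕ → List ℕ → ℕ → Term
  | x :: xs, m :: s => updateNums (Function.update σ x (num m)) xs s
  | _, _ => σ

theorem extend_const {α : Type*} (x : ℕ) (f : Fin 1 → α) (g : ℕ → α) :
    Function.extend (fun _ : Fin 1 => x) f g = Function.update g x (f 0) := by
  funext y
  by_cases h : y = x
  · subst h
    have hinj : Function.Injective fun _ : Fin 1 => y := fun i j _ => Subsingleton.elim i j
    simpa using hinj.extend_apply f g 0
  · rw [Function.extend_apply' _ _ _ (by rintro ⟨_, h'⟩; exact h h'.symm),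
      Function.update_of_ne h]

theorem unfold_lams {M : Term} (hM : M.IsPure) {xs s : List ℕ} (h : xs.length = s.length)
    (σ : ℕ → Term) : Unfold (lams xs M) s σ (M.subst (updateNums σ xs s)) := by
  induction xs generalizing s σ with
  | nil =>
    obtain rfl := List.length_eq_zero_iff.1 h.symm
    exact .base hM
  | cons x xs ih =>
    rcases s with _ | ⟨m, s⟩
    · cases h
    refine .lam ?_
    rw [abstr, rename_eq_subst]
    refine (ih (Nat.succ.inj h) _).subst (fun y => ?_) fun _ => trivial
    rw [extend_const]
    by_cases hy : y = x
    · subst hy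
      simp [Term.subst, consSub]
    · simp [Term.subst, consSub, hy]

theorem updateNums_of_notMem {xs : List ℕ} {x : ℕ} (h : x ∉ xs) (σ : ℕ → Term) (s : List ℕ) :
    updateNums σ xs s x = σ x := by
  induction xs generalizing σ s with
  | nil => rfl
  | cons y xs ih =>
    cases s with
    | nil => rfl
    | cons m s =>
      rw [List.mem_cons, not_or] at h
      rw [updateNums, ih h.2, Function.update_of_ne h.1]

theorem map_updateNums {xs s : List ℕ} (hxs : xs.Nodup) (h : xs.length = s.length)
    (σ : ℕ → Term) : xs.map (updateNums σ xs s) = s.map num := by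
  induction xs generalizing s σ with
  | nil =>
    obtain rfl := List.length_eq_zero_iff.1 h.symm
    rfl
  | cons x xs ih =>
    rcases s with _ | ⟨m, s⟩
    · cases h
    rw [List.nodup_cons] at hxs
    rw [List.map_cons, List.map_cons, updateNums, updateNums_of_notMem hxs.1,
      Function.update_self, ih hxs.2 (Nat.succ.inj h)]

/-! ### Well-formed terms -/

theorem distinct_map_bang {Δ : Multiset ℕ} : Env.Distinct (Δ.map .bang) ↔ Δ.Nodup := by
  rw [Env.Distinct, Multiset.bind_map]
  simp only [Entry.names, Multiset.bind_singleton]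
  exact Multiset.nodup_map_iff_of_injective Sum.inl_injective

theorem distinct_map_lin {Δ : Multiset ℕ} : Env.Distinct (Δ.map .lin) ↔ Δ.Nodup := by
  rw [Env.Distinct, Multiset.bind_map]
  have h (x : ℕ) : (Entry.lin x).names = {Sum.inl x} := rfl
  simp only [h, Multiset.bind_singleton]
  exact Multiset.nodup_map_iff_of_injective Sum.inl_injective

theorem Judgement.weak_many {M : Term} (Δ : Multiset ℕ) {Θ : Multiset ℕ}
    (h : Judgement (Θ.map .bang) M) (hΔ : (Δ + Θ).Nodup) :
    Judgement ((Δ + Θ).map .bang) M := by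
  induction Δ using Multiset.induction_on with
  | empty => rwa [zero_add]
  | cons x Δ ih =>
    rw [Multiset.cons_add] at hΔ ⊢
    have := ih hΔ.of_cons
    rw [Multiset.map_cons]
    exact .weak x this (by rw [← Multiset.map_cons]; exact distinct_map_bang.2 hΔ)

/-- Each `x` is contracted with its copy `x + K`, one pair at a time; variables already treated are
moved to `Θ`. The composite renaming `r` undoes the shift by `K` on the copies. -/
theorem Judgement.contr_many {M : Term} {K : ℕ} (Δ Θ : Multiset ℕ)
    (h : Judgement ((Δ + Δ.map (· + K) + Θ).map .bang) M)
    (hnd : (Δ + Δ.map (· + K) + Θ).Nodup) (hK : ∀ x ∈ Δ, x < K) :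
    ∃ r : ℕ → ℕ, Judgement ((Δ + Θ).map .bang) (M.rename r) ∧ (∀ y ∈ Δ, r (y + K) = y) ∧
      ∀ y < K, r y = y := by
  induction Δ using Multiset.induction_on generalizing M Θ with
  | empty =>
    refine ⟨id, ?_, by simp, fun _ _ => rfl⟩
    rw [rename_eq_subst]
    simpa using h
  | cons x Δ ih =>
    have e : (x ::ₘ Δ) + (x ::ₘ Δ).map (· + K) + Θ =
        x ::ₘ (x + K) ::ₘ (Δ + Δ.map (· + K) + Θ) := by
      rw [Multiset.map_cons, Multiset.cons_add, Multiset.add_cons, Multiset.cons_add,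
        Multiset.cons_add]
    rw [e] at h hnd
    rw [Multiset.map_cons, Multiset.map_cons] at h
    have hnd' : (x ::ₘ (Δ + Δ.map (· + K) + Θ)).Nodup := by
      rw [Multiset.cons_swap] at hnd
      exact hnd.of_cons
    have h' := Judgement.contr x (x + K) x h
      (by rw [← Multiset.map_cons]; exact distinct_map_bang.2 hnd')
    have e' : x ::ₘ (Δ + Δ.map (· + K) + Θ) = Δ + Δ.map (· + K) + (x ::ₘ Θ) := by
      rw [Multiset.add_cons]
    rw [← Multiset.map_cons, e'] at h'
    rw [e'] at hnd'
    have hx : x < K := hK x (Multiset.mem_cons_self x Δ)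
    obtain ⟨r, hr, hr₁, hr₂⟩ := ih (x ::ₘ Θ) h' hnd' fun y hy => hK y (Multiset.mem_cons_of_mem hy)
    refine ⟨r ∘ fun w => if w = x ∨ w = x + K then x else w, ?_, ?_, ?_⟩
    · rw [rename_rename, Multiset.add_cons, ← Multiset.cons_add] at hr
      exact hr
    · intro y hy
      simp only [Function.comp_apply]
      split_ifs with hc
      · rw [hr₂ x hx]
        rcases hc with hc | hc <;> omega
      · rcases Multiset.mem_cons.1 hy with rfl | hy
        · simp at hc
        · exact hr₁ y hy
    · intro y hy
      simp only [Function.comp_apply]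
      split_ifs with hc
      · rw [hr₂ x hx]
        rcases hc with hc | hc <;> omega
      · exact hr₂ y hy

/-- When all variables are duplicable the typing rules impose no linearity: dereliction and
weakening handle variables, promotion handles boxes, and contraction merges the two environments of
an application. The renaming `ρ` names the de Bruijn indices. -/
theorem Term.PureBelow.judgement {k : ℕ} {M : Term} (h : M.PureBelow k) {ρ : ℕ → ℕ}
    {Δ : Multiset ℕ} (hΔ : Δ.Nodup) (hρ : ∀ i < k, ρ i ∈ Δ) :
    Judgement (Δ.map .bang) (M.rename ρ) := by
  induction M generalizing k ρ Δ with
  | var i =>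
    obtain ⟨Θ, rfl⟩ := Multiset.exists_cons_of_mem (hρ i h)
    have h' : Judgement (({ρ i} : Multiset ℕ).map .bang) (.var (ρ i)) := by
      simpa using Judgement.der (Γ := 0) (ρ i) (Judgement.var (ρ i))
    have e : ρ i ::ₘ Θ = Θ + {ρ i} := by rw [add_comm, Multiset.singleton_add]
    rw [e] at hΔ ⊢
    exact h'.weak_many Θ hΔ
  | bang M ih => exact .prom (ih (k := k) h hΔ hρ)
  | app M N ihM ihN =>
    -- Application requires disjoint environments, so `N` is typed with its variables shifted beyond
    -- those of `M`, and the copies are contracted afterwards.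
    obtain ⟨K, hK⟩ : ∃ K, ∀ x ∈ Δ, x < K :=
      ⟨Δ.sup + 1, fun x hx => Nat.lt_succ_of_le (Multiset.le_sup hx)⟩
    have hinj : Function.Injective fun x : ℕ => x + K := add_left_injective K
    have hnd : (Δ + Δ.map (· + K)).Nodup := by
      refine Multiset.nodup_add.2 ⟨hΔ, hΔ.map hinj, Multiset.disjoint_left.2 fun {x} hx hx' => ?_⟩
      obtain ⟨y, -, rfl⟩ := Multiset.mem_map.1 hx'
      have := hK _ hx
      omega
    have hM := ihM h.1 hΔ hρ
    have hN := ihN (ρ := fun i => ρ i + K) h.2 (hΔ.map hinj) fun i hi =>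
      Multiset.mem_map_of_mem _ (hρ i hi)
    have hMN := Judgement.app hM hN
      (by rw [← Multiset.map_add]; exact distinct_map_bang.2 hnd)
    rw [← Multiset.map_add, ← add_zero (Δ + _)] at hMN
    obtain ⟨r, hr, hr₁, hr₂⟩ := Judgement.contr_many Δ 0 hMN (by rwa [add_zero]) hK
    rw [add_zero, Term.rename, rename_rename, rename_rename] at hr
    rw [Term.rename, h.1.rename_congr (ρ' := r ∘ ρ) fun i hi => (hr₂ _ (hK _ (hρ i hi))).symm,
      h.2.rename_congr (ρ' := r ∘ fun i => ρ i + K) fun i hi => (hr₁ _ (hρ i hi)).symm]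
    exact hr
  | lamBang M ih =>
    obtain ⟨x, hx⟩ : ∃ x, x ∉ Δ := by
      refine ⟨Δ.sup + 1, fun hx => ?_⟩
      have : Δ.sup + 1 ≤ Δ.sup := Multiset.le_sup hx
      omega
    let ρ' : ℕ → ℕ := fun i => if i = 0 then x else ρ (i - 1)
    have hM := ih (k := k + 1) (ρ := ρ') (Δ := x ::ₘ Δ) h (Multiset.nodup_cons.2 ⟨hx, hΔ⟩)
      fun i hi => by
        cases i with
        | zero => simp [ρ']
        | succ i => simpa [ρ'] using .inr (hρ i (by omega))
    rw [Multiset.map_cons] at hM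
    have := Judgement.to_intro x hM
    rw [abstr, rename_rename] at this
    rw [Term.rename]
    convert this using 2
    refine Term.PureBelow.rename_congr (k := k + 1) h fun i hi => ?_
    rw [extend_const]
    cases i with
    | zero => simp [ρ', liftRen]
    | succ i =>
      have hne : ρ i ≠ x := fun h => hx (h ▸ hρ i (by omega))
      simp [ρ', liftRen, hne]
  | qvar | bool | unitary | new | tuple | lam => exact h.elim

theorem Term.PureBelow.judgement_zero {M : Term} (h : M.PureBelow 0) : Judgement 0 M := by
  have := h.judgement (ρ := id) (Δ := 0) Multiset.nodup_zero (by simp)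
  rw [rename_eq_subst] at this
  simpa using this

/-- Each argument occurs exactly once and outside all boxes, so linear variables suffice; the
surrounding pieces are closed. -/
theorem judgement_buildTerm {xs : List ℕ} (hxs : xs.Nodup) :
    Judgement ((xs : Multiset ℕ).map .lin) (buildTerm (xs.map var)) := by
  induction xs with
  | nil => exact PureBelow.judgement_zero (M := bang (listTerm [])) (pureBelow_listTerm 0 [])
  | cons x xs ih =>
    have hx : Env.Distinct (({x} : Multiset ℕ).map .lin) :=
      distinct_map_lin.2 (Multiset.nodup_singleton x)
    have h₁ : Judgement (({x} : Multiset ℕ).map .lin) (var x) := by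
      simpa using Judgement.var x
    have h₂ := h₁.app (N := bang (lamBang (bang (succTerm (var 2)))))
      (PureBelow.judgement_zero (by simp [PureBelow, succTerm])) (by rwa [add_zero])
    have h₃ := h₂.app (N := bang (bang (num 0)))
      (PureBelow.judgement_zero (pureBelow_num 0 0)) (by rwa [add_zero, add_zero])
    have h₄ := Judgement.app (M := lamBang (lamBang (bang (consTerm (var 3) (var 2)))))
      (PureBelow.judgement_zero (by simp [PureBelow, consTerm])) h₃
      (by rwa [add_zero, add_zero, zero_add])
    rw [add_zero, add_zero, zero_add] at h₄
    have e : ((x :: xs : List ℕ) : Multiset ℕ) = {x} + (xs : Multiset ℕ) := by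
      rw [Multiset.singleton_add, Multiset.cons_coe]
    rw [e, Multiset.map_add]
    refine h₄.app (ih (List.nodup_cons.1 hxs).2) ?_
    rw [← Multiset.map_add, ← e]
    exact distinct_map_lin.2 (Multiset.coe_nodup.2 hxs)

theorem judgement_computeTerm (c : Code) {xs : List ℕ} (hxs : xs.Nodup) :
    Judgement ((xs : Multiset ℕ).map .lin) (computeTerm c (xs.map var)) := by
  have hd : Env.Distinct ((xs : Multiset ℕ).map .lin) :=
    distinct_map_lin.2 (Multiset.coe_nodup.2 hxs)
  have h₁ := (pureBelow_codeTerm 0 c).judgement_zero.app (judgement_buildTerm hxs)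
    (by rwa [zero_add])
  rw [zero_add] at h₁
  have h₂ := Judgement.app (M := headTerm)
    (PureBelow.judgement_zero (by simp [PureBelow, headTerm, pureBelow_num])) h₁
    (by rwa [zero_add])
  rwa [zero_add] at h₂

theorem Judgement.lams {xs : List ℕ} {Γ : Env} {M : Term}
    (h : Judgement (Γ + (xs : Multiset ℕ).map .lin) M) : Judgement Γ (lams xs M) := by
  induction xs generalizing Γ with
  | nil => simpa [QCalc.lams] using h
  | cons x xs ih =>
    refine .limp_intro 0 (fun _ => x) (ih ?_)
    rw [← Multiset.cons_coe, Multiset.map_cons, Multiset.add_cons, ← Multiset.cons_add] at h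
    exact h

theorem Term.IsPure.qvars_eq {M : Term} (h : M.IsPure) : M.qvars = ∅ := by
  induction M with
  | var => rfl
  | bang M ih => exact ih h
  | app M N ihM ihN => rw [qvars, ihM h.1, ihN h.2, Finset.empty_union]
  | lamBang M ih => exact ih h
  | qvar | bool | unitary | new | tuple | lam => exact h.elim

theorem qvars_lams (xs : List ℕ) (M : Term) : (lams xs M).qvars = M.qvars := by
  induction xs with
  | nil => rfl
  | cons x xs ih => rw [lams, qvars, abstr, qvars_rename, ih]

/-! ### Partial recursive functions are representable -/

theorem representable_of_partrec (U : ℕ → Σ n, Gate n) {n : ℕ} {f : List.Vector ℕ n →. ℕ}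
    (hf : Partrec f) : Representable U f := by
  obtain ⟨c, hc⟩ := Code.exists_code (Nat.Partrec'.part_iff.2 hf)
  let xs := List.range n
  have hxs : xs.Nodup := List.nodup_range
  have hp : (computeTerm c (xs.map var)).IsPure := isPure_computeTerm c fun M hM => by
    obtain ⟨x, -, rfl⟩ := List.mem_map.1 hM
    trivial
  refine ⟨lams xs (computeTerm c (xs.map var)), ?_, (represents_iff U _ f).2 fun v => ?_⟩
  · rw [WellFormed, qvars_lams, hp.qvars_eq]
    exact Judgement.lams (by simpa using judgement_computeTerm c hxs)
  have hlen : xs.length = v.toList.length := by simp [xs]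
  have hu : Unfold (appNums (lams xs (computeTerm c (xs.map var))) v) [] var
      (computeTerm c (v.toList.map num)) := by
    have := unfold_lams hp hlen var
    rw [subst_computeTerm, List.map_map] at this
    have e : xs.map ((fun M => M.subst (updateNums var xs v.toList)) ∘ var) =
        v.toList.map num := map_updateNums hxs hlen var
    rw [e] at this
    exact Unfold.foldl_app (by rwa [List.append_nil])
  have hred : TSteps (appNums (lams xs (computeTerm c (xs.map var))) v)
      (computeTerm c (v.toList.map num)) := by
    simpa using hu.tSteps_foldl
  have hval : ∀ m ∈ f v, CSteps (computeTerm c (v.toList.map num)) (num m) := fun m hm => by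
    have h : [m] ∈ c.eval v.toList := by
      change _ ∈ c.eval v.1
      rw [hc v]
      exact (Part.mem_map_iff _).2 ⟨m, hm, rfl⟩
    exact cSteps_computeTerm h
  -- A normal form forces strong normalization, hence a defined value of `f`; uniqueness of normal
  -- forms then identifies it with that numeral.
  have hnormal : ∀ N, CSteps (computeTerm c (v.toList.map num)) N → (∀ N', ¬ CStep N N') →
      ∃ m ∈ f v, N = num m := fun N hN hN' => by
    have h : (c.eval v.1).Dom := dom_eval_of_sn_computeTerm (SN.of_normal hN hN')
    rw [hc v] at h
    obtain ⟨m, hm⟩ : ∃ m, m ∈ f v := Part.dom_iff_mem.1 h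
    exact ⟨m, hm, hN.eq_of_normal (hval m hm) hN' (not_cStep_num m)⟩
  refine ⟨fun N hN hN' => ?_, fun m => ⟨fun h => ?_, fun hm => ?_⟩⟩
  -- The arbitrary reduction is projected to a `cβ`-reduction of the unfolded program, which ends in
  -- the same term as the latter is normal.
  · obtain ⟨P, hP, hP'⟩ := hu.tSteps hN
    obtain rfl := hP.eq_of_normal hN'
    obtain ⟨m, -, hm⟩ := hnormal P hP' fun N' h => hN' N' h.tStep
    exact ⟨m, hm⟩
  · obtain ⟨P, hP, hP'⟩ := hu.tSteps h
    obtain rfl := hP.eq_of_normal (not_tStep_num m)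
    obtain ⟨m', hm', h'⟩ := hnormal _ hP' (not_cStep_num m)
    rwa [num_injective h']
  · exact hred.trans (hval m hm).tSteps

end QCalc

end

theorem mainTheorem5 (U : ℕ → Σ n, QCalc.Gate n) (n : ℕ) :
    {f : List.Vector ℕ n →. ℕ | QCalc.Representable U f} =
      {f : List.Vector ℕ n →. ℕ | Partrec f} :=
  Set.ext fun _ => ⟨QCalc.partrec_of_representable, QCalc.representable_of_partrec U⟩
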